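/- Let $N\ge 3$, $k_p\in\{0,2\}$, $\theta_0\in(0,\pi)$, $\theta_0\ne\pi/2$, and $\lambda_n\in\mathbb R\setminus\{0\}$. On the unit sphere $S^2\subset\mathbb R^3$ put vortices of vorticity $+1$ at the points $x_j$ of co-latitude $\theta_0$ and longitude $\varphi_j=2\pi (j-1)/N$, and vortices of vorticity $-1$ at the points $x_j'$ of co-latitude $\pi-\theta_0$ and longitude $\varphi_j+\varphi_0$ ($1\le j\le N$), where $\varphi_0=\pi/N$ (type $D_{Nd}(R,R',k_pp)$) or $\varphi_0=0$ (type $D_{Nh}(2R,k_pp)$); if $k_p=2$, put moreover vortices of vorticities $\lambda_n$ and $-\lambda_n$ at the North and South poles. Let $x_e$ be this configuration, $\lambda_i$ the vorticity of its $i$-th vortex, and $$H=\sum_{i<j}\lambda_i\lambda_j\ln\|x_i-x_j\|^2,\qquad X_H(x)_i=\sum_{j\ne i}\frac{\lambda_j\,x_j\times x_i}{1-x_i\cdot x_j},\qquad \Phi=\sum_i\lambda_ix_i,\qquad \omega=\sum_i\lambda_i\sin\theta_i\,d\theta_i\wedge d\phi_i$$ (each summand of $\omega$ being $\lambda_i$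 times the area form of the $i$-th sphere, also at the poles). Put $\mu=\Phi(x_e)$ and assume $\mu\ne0$. Let $\mathcal G=T_{x_e}(SO(3)_\mu\cdot x_e)^{\perp}\cap\operatorname{Ker}D\Phi(x_e)$ be the symplectic slice, where $SO(3)_\mu$ is the stabilizer of $\mu$ in $SO(3)$ and $\perp$ refers to the product metric. Let $\delta\theta_j,\delta\phi_j$ (resp. $\delta\theta_j',\delta\phi_j'$) be the coordinate tangent vectors $\partial/\partial\theta,\partial/\partial\phi$ at $x_j$ (resp. $x_j'$), and $(\delta x_n,\delta y_n)$, $(\delta x_s,\delta y_s)$ the tangent vectors $(e_x,e_y)$ at the North and South poles. For $u\in\{\theta,\phi\}$ define real tangent vectors by $$\alpha_{q,u}+i\beta_{q,u}=\sum_{j=1}^Ne^{2i\pi q(j-1)/N}\big(\delta u_j+e^{iq\varphi_0}\delta u_j'\big),\qquad \alpha'_{q,u}+i\beta'_{q,u}=\sum_{j=1}^Ne^{2i\pi q(j-1)/N}\big(\delta u_j-e^{iq\varphi_0}\delta u_j'\big),$$ and $\delta x_p=\delta x_n+\delta x_s$, $\delta y_p=\delta y_n+\delta y_s$, $\delta x_p'=\delta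 x_n-\delta x_s$, $\delta y_p'=\delta y_n-\delta y_s$. Consider the following lists of vectors, where a semicolon separates the two halves of a list. 1. $\alpha_{0,\theta}\,;\ \alpha_{0,\phi}'$. 2. If $k_p=0$: $\ \beta_{1,\phi},\alpha_{1,\theta}'\,;\ \alpha_{1,\phi},\beta_{1,\theta}'$. If $k_p=2$: $\ \beta_{1,\phi},\alpha_{1,\theta}',\delta x_p\,;\ \alpha_{1,\phi},\beta_{1,\theta}',\delta y_p$. 3. If $k_p=0$: $\ \sin\theta_0\,\alpha_{1,\theta}+\cos\theta_0\,\beta_{1,\phi}'\,;\ \sin\theta_0\,\beta_{1,\theta}-\cos\theta_0\,\alpha_{1,\phi}'$. If $k_p=2$: $\ \sin\theta_0\,\alpha_{1,\theta}+\cos\theta_0\,\beta_{1,\phi}',\ \alpha_{1,\theta}-\frac{N}{2\lambda_n}\cos\theta_0\,\delta x_p'\,;\ \sin\theta_0\,\beta_{1,\theta}-\cos\theta_0\,\alpha_{1,\phi}',\ \beta_{1,\theta}-\frac{N}{2\lambda_n}\cos\theta_0\,\delta y_p'$. 4. For each integer $q$ with $2\le q<N/2$, the two lists $\ \alpha_{q,\theta},\beta_{q,\phi}'\,;\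 \beta_{q,\theta},\alpha_{q,\phi}'\ $ and $\ \alpha_{q,\theta}',\beta_{q,\phi}\,;\ \beta_{q,\theta}',\alpha_{q,\phi}$. 5. If $N$ is even: $\ \alpha_{N/2,\theta}',\beta_{N/2,\phi}\,;\ \beta_{N/2,\theta}',\alpha_{N/2,\phi}\ $ for type $D_{Nd}$, and $\ \alpha_{N/2,\theta},\alpha_{N/2,\theta}'\,;\ \alpha_{N/2,\phi},\alpha_{N/2,\phi}'\ $ for type $D_{Nh}$. Then: (a) All these vectors together form a basis of $\mathcal G$, and the matrix $\Omega_{\mathcal G}$ of $\omega|_{\mathcal G}$ in this basis is invertible. (b) $x_e$ is a relative equilibrium: there is exactly one $\xi\in\mathbb R^3$ (its angular velocity) with $X_H(x_e)_i=\xi\times x_i$ for every vortex $x_i$ of $x_e$. For this $\xi$ let $H_\xi=H+\langle\Phi-\mu,\xi\rangle$. (c) In this basis the matrix of the Hessian $d^2H_\xi|_{\mathcal G}(x_e)$ is block diagonal, each half of a list giving one block. Thus all its blocks are $2\times2$, except four $1\times1$ blocks if $k_p=0$, and except two $3\times3$ and two $1\times1$ blocks if $k_p=2$. (d) In this basis the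 matrix $L=\Omega_{\mathcal G}^{-1}\,d^2H_\xi|_{\mathcal G}(x_e)$ of the linearized system is block diagonal, each whole list giving one block. Thus all its blocks are $4\times4$, except two $2\times2$ blocks if $k_p=0$, and except one $6\times6$ and one $2\times2$ block if $k_p=2$. -/

import Mathlib

open Matrix

noncomputable section

namespace PointVortex

/-- Relative position of the two rings: `Nd` is `D_{Nd}(R,R')` (rings out of phase by `π / N`),
`Nh` is `D_{Nh}(2R)` (rings in phase). -/
inductive Shape where
  | Nd
  | Nh

/-- Presence of polar vortices: `k_p = 0` or `k_p = 2`. -/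
inductive Poles where
  | absent
  | two

/-- The number `k_p` of polar vortices. -/
@[reducible] def Poles.count : Poles → ℕ
  | .absent => 0
  | .two => 2

/-- Labels of the vortices: the `N` vortices of the (+)ring, the `N` vortices of the (-)ring, and
the polar vortices (`0` is the North pole, `1` is the South pole). -/
abbrev Vortex (N : ℕ) (p : Poles) : Type := Fin N ⊕ Fin N ⊕ Fin p.count

/-- One vector of `ℝ³` for each vortex. Positions of vortices are the points of this space all of
whose components are unit vectors; tangent vectors at `x` are the `v` with `v i ⬝ᵥ x i = 0`. -/
abbrev Ambient (N : ℕ) (p : Poles) : Type := Vortex N p → Fin 3 → ℝ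

section Dynamics

variable {N : ℕ} {p : Poles}

/-- Vorticities: `+1` and `-1` on the rings, `lam` at the North pole, `-lam` at the South pole. -/
def vorticity (lam : ℝ) : Vortex N p → ℝ
  | .inl _ => 1
  | .inr (.inl _) => -1
  | .inr (.inr k) => if k.val = 0 then lam else -lam

/-- The Hamiltonian `∑_{i<j} λ_i λ_j log ‖x_i - x_j‖²`. -/
def hamiltonian (lam : ℝ) (x : Ambient N p) : ℝ :=
  (1 / 2) * ∑ i, ∑ j, if i = j then 0 else
    vorticity lam i * vorticity lam j * Real.log ((x i - x j) ⬝ᵥ (x i - x j))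

/-- The vector field `X_H(x)_i = ∑_{j ≠ i} λ_j (x_j × x_i) / (1 - x_i · x_j)`. -/
def vectorField (lam : ℝ) (x : Ambient N p) (i : Vortex N p) : Fin 3 → ℝ :=
  ∑ j, if j = i then 0 else (vorticity lam j / (1 - x i ⬝ᵥ x j)) • (x j ⨯₃ x i)

/-- The infinitesimal generator `ξ_P(x) = (ξ × x_i)_i` of the diagonal action of `SO(3)`, where
`so(3)` is identified with `ℝ³` equipped with the cross product. -/
def generator (ξ : Fin 3 → ℝ) (x : Ambient N p) : Ambient N p := fun i => ξ ⨯₃ x i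

/-- `x` is a relative equilibrium with angular velocity `ξ`: the solution through `x` is
`t ↦ exp(t ξ) · x`, that is, `X_H(x) = ξ_P(x)`. -/
def IsRelativeEquilibrium (lam : ℝ) (x : Ambient N p) (ξ : Fin 3 → ℝ) : Prop :=
  vectorField lam x = generator ξ x

/-- The centre of vorticity `Φ(x) = ∑ λ_i x_i`. It is linear in `x`, so that its differential at a
point is the same expression applied to tangent vectors. -/
def momentum (lam : ℝ) (x : Ambient N p) : Fin 3 → ℝ := ∑ i, vorticity lam i • x i

/-- The augmented Hamiltonian `H_ξ(x) = H(x) + ⟨Φ(x) - μ, ξ⟩`. -/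
def augmentedHamiltonian (lam : ℝ) (μ ξ : Fin 3 → ℝ) (x : Ambient N p) : ℝ :=
  hamiltonian lam x + (momentum lam x - μ) ⬝ᵥ ξ

/-- Projection of each component onto the unit sphere. -/
def radialProjection (y : Ambient N p) : Ambient N p :=
  fun i => (Real.sqrt (y i ⬝ᵥ y i))⁻¹ • y i

/-- The Hessian, at the point `x` of the product of unit spheres, of the restriction of `f` to this
product. On tangent vectors, the Euclidean second derivative of the extension of `f` which is
constant along the radial directions is the Riemannian Hessian of the restriction; at a critical
point this is the second differential computed in any coordinates. -/
def hessian (f : Ambient N p → ℝ) (x u v : Ambient N p) : ℝ :=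
  fderiv ℝ (fderiv ℝ (fun y => f (radialProjection y))) x u v

/-- The symplectic form `ω = ∑ λ_i sin θ_i dθ_i ∧ dφ_i`, i.e. the sum of the area forms
`(u, v) ↦ x_i · (u × v)` of the unit spheres weighted by the vorticities. -/
def symplecticForm (lam : ℝ) (x u v : Ambient N p) : ℝ :=
  ∑ i, vorticity lam i * (x i ⬝ᵥ (u i ⨯₃ v i))

/-- The symplectic slice `T_x(SO(3)_μ · x)^⊥ ∩ Ker DΦ(x)`, `μ = Φ(x)`, inside the tangent space
at `x`. The tangent space `T_x(SO(3)_μ · x)` consists of the vectors `η_P(x)`, for `η` in the Lie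
algebra `{η | η × μ = 0}` of `SO(3)_μ`, and `⊥` refers to the metric of the product of spheres. -/
def symplecticSlice (lam : ℝ) (x : Ambient N p) : Submodule ℝ (Ambient N p) where
  carrier := {v | (∀ i, v i ⬝ᵥ x i = 0) ∧ momentum lam v = 0 ∧
    ∀ η : Fin 3 → ℝ, η ⨯₃ momentum lam x = 0 → ∑ i, v i ⬝ᵥ generator η x i = 0}
  zero_mem' := by simp [momentum]
  add_mem' := by
    rintro a b ⟨ha1, ha2, ha3⟩ ⟨hb1, hb2, hb3⟩
    refine ⟨fun i => ?_, ?_, fun η hη => ?_⟩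
    · simp [add_dotProduct, ha1 i, hb1 i]
    · have h : momentum lam (a + b) = momentum lam a + momentum lam b := by
        simp [momentum, Finset.sum_add_distrib]
      rw [h, ha2, hb2, add_zero]
    · simp only [Pi.add_apply, add_dotProduct, Finset.sum_add_distrib, ha3 η hη, hb3 η hη,
        add_zero]
  smul_mem' := by
    rintro c a ⟨ha1, ha2, ha3⟩
    refine ⟨fun i => ?_, ?_, fun η hη => ?_⟩
    · simp [smul_dotProduct, ha1 i]
    · have h : momentum lam (c • a) = c • momentum lam a := by
        simp only [momentum, Pi.smul_apply, Finset.smul_sum]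
        exact Finset.sum_congr rfl fun i _ => smul_comm _ _ _
      rw [h, ha2, smul_zero]
    · simp only [Pi.smul_apply, smul_dotProduct, ← Finset.smul_sum, ha3 η hη, smul_zero]

end Dynamics

section Configuration

/-- The point of the unit sphere of co-latitude `θ` and longitude `φ`. -/
def spherical (θ φ : ℝ) : Fin 3 → ℝ :=
  ![Real.sin θ * Real.cos φ, Real.sin θ * Real.sin φ, Real.cos θ]

/-- The tangent vector `∂/∂θ` at the point `spherical θ φ`. -/
def dSphericalTheta (θ φ : ℝ) : Fin 3 → ℝ :=
  ![Real.cos θ * Real.cos φ, Real.cos θ * Real.sin φ, -Real.sin θ]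

/-- The tangent vector `∂/∂φ` at the point `spherical θ φ`. -/
def dSphericalPhi (θ φ : ℝ) : Fin 3 → ℝ :=
  ![-(Real.sin θ * Real.sin φ), Real.sin θ * Real.cos φ, 0]

/-- The offset `φ₀` between the two rings. -/
def offset (N : ℕ) : Shape → ℝ
  | .Nd => Real.pi / N
  | .Nh => 0

/-- Longitude `2π j / N` of the vortex `j = 0, …, N - 1` of the (+)ring. -/
def longitude {N : ℕ} (j : Fin N) : ℝ := 2 * Real.pi * j / N

/-- The configuration `D_{Nd}(R,R',k_p p)` or `D_{Nh}(2R,k_p p)` with (+)ring at co-latitude `θ₀`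
and (-)ring at co-latitude `π - θ₀`. -/
def configuration (N : ℕ) (s : Shape) (p : Poles) (θ₀ : ℝ) : Ambient N p
  | .inl j => spherical θ₀ (longitude j)
  | .inr (.inl j) => spherical (Real.pi - θ₀) (longitude j + offset N s)
  | .inr (.inr k) => if k.val = 0 then ![0, 0, 1] else ![0, 0, -1]

variable (N : ℕ) (s : Shape) (p : Poles) (θ₀ : ℝ)

/-- `δθ_j`, at the vortex `j` of the (+)ring. -/
def δθ (j : Fin N) : Ambient N p :=
  Pi.single (.inl j) (dSphericalTheta θ₀ (longitude j))

/-- `δφ_j`, at the vortex `j` of the (+)ring. -/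
def δφ (j : Fin N) : Ambient N p :=
  Pi.single (.inl j) (dSphericalPhi θ₀ (longitude j))

/-- `δθ'_j`, at the vortex `j` of the (-)ring. -/
def δθ' (j : Fin N) : Ambient N p :=
  Pi.single (.inr (.inl j)) (dSphericalTheta (Real.pi - θ₀) (longitude j + offset N s))

/-- `δφ'_j`, at the vortex `j` of the (-)ring. -/
def δφ' (j : Fin N) : Ambient N p :=
  Pi.single (.inr (.inl j)) (dSphericalPhi (Real.pi - θ₀) (longitude j + offset N s))

/-- The real part of `∑_j e^{2iπqj/N} (a_j + ε e^{iqφ₀} b_j)`, `j = 0, …, N - 1`. -/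
def modeRe (q : ℕ) (ε : ℝ) (a b : Fin N → Ambient N p) : Ambient N p :=
  ∑ j, (Real.cos (q * longitude j) • a j +
    (ε * Real.cos (q * (longitude j + offset N s))) • b j)

/-- The imaginary part of `∑_j e^{2iπqj/N} (a_j + ε e^{iqφ₀} b_j)`, `j = 0, …, N - 1`. -/
def modeIm (q : ℕ) (ε : ℝ) (a b : Fin N → Ambient N p) : Ambient N p :=
  ∑ j, (Real.sin (q * longitude j) • a j +
    (ε * Real.sin (q * (longitude j + offset N s))) • b j)

/-- `α_{q,θ}` -/
def αθ (q : ℕ) : Ambient N p := modeRe N s p q 1 (δθ N p θ₀) (δθ' N s p θ₀)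

/-- `β_{q,θ}` -/
def βθ (q : ℕ) : Ambient N p := modeIm N s p q 1 (δθ N p θ₀) (δθ' N s p θ₀)

/-- `α'_{q,θ}` -/
def αθ' (q : ℕ) : Ambient N p := modeRe N s p q (-1) (δθ N p θ₀) (δθ' N s p θ₀)

/-- `β'_{q,θ}` -/
def βθ' (q : ℕ) : Ambient N p := modeIm N s p q (-1) (δθ N p θ₀) (δθ' N s p θ₀)

/-- `α_{q,φ}` -/
def αφ (q : ℕ) : Ambient N p := modeRe N s p q 1 (δφ N p θ₀) (δφ' N s p θ₀)

/-- `β_{q,φ}` -/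
def βφ (q : ℕ) : Ambient N p := modeIm N s p q 1 (δφ N p θ₀) (δφ' N s p θ₀)

/-- `α'_{q,φ}` -/
def αφ' (q : ℕ) : Ambient N p := modeRe N s p q (-1) (δφ N p θ₀) (δφ' N s p θ₀)

/-- `β'_{q,φ}` -/
def βφ' (q : ℕ) : Ambient N p := modeIm N s p q (-1) (δφ N p θ₀) (δφ' N s p θ₀)

/-- The vector `w_n + ε w_s`, with `w` at both poles. -/
def polar (ε : ℝ) (w : Fin 3 → ℝ) : Ambient N .two :=
  Pi.single (.inr (.inr 0)) w + Pi.single (.inr (.inr 1)) (ε • w)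

/-- `δx_p = δx_n + δx_s` -/
def δxp : Ambient N .two := polar N 1 ![1, 0, 0]

/-- `δy_p = δy_n + δy_s` -/
def δyp : Ambient N .two := polar N 1 ![0, 1, 0]

/-- `δx'_p = δx_n - δx_s` -/
def δxp' : Ambient N .two := polar N (-1) ![1, 0, 0]

/-- `δy'_p = δy_n - δy_s` -/
def δyp' : Ambient N .two := polar N (-1) ![0, 1, 0]

end Configuration

section Slice

/-- Labels of the diagonal blocks of the linearized matrix `L`:
* `zero`: the block of `α_{0,θ}, α'_{0,φ}`;
* `one`: the block of the rest of `B⁰` (resp. `B⁰_p`);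
* `bOne`: the block `B¹` (resp. `B¹_p`);
* `low q`: the block of `α_{q,θ}, β'_{q,φ}, β_{q,θ}, α'_{q,φ}`, for `2 ≤ q < N / 2`;
* `low' q`: the block of `α'_{q,θ}, β_{q,φ}, β'_{q,θ}, α_{q,φ}`, for `2 ≤ q < N / 2`;
* `half`: the block of mode `N / 2`, only for `N` even. -/
inductive LBlock (N : ℕ) : Type where
  | zero
  | one
  | bOne
  | low (q : ℕ) (hq : 2 ≤ q ∧ 2 * q < N)
  | low' (q : ℕ) (hq : 2 ≤ q ∧ 2 * q < N)
  | half (hN : Even N)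

/-- An injective encoding, used for finiteness only. -/
def LBlock.code {N : ℕ} : LBlock N → Fin 6 × Fin (N + 1)
  | .zero => (0, 0)
  | .one => (1, 0)
  | .bOne => (2, 0)
  | .low q hq => (3, ⟨q, by omega⟩)
  | .low' q hq => (4, ⟨q, by omega⟩)
  | .half _ => (5, 0)

theorem LBlock.code_injective (N : ℕ) : Function.Injective (LBlock.code (N := N)) := by
  intro a b h
  cases a <;> cases b <;> simp_all [LBlock.code]

instance (N : ℕ) : Fintype (LBlock N) := Fintype.ofInjective _ (LBlock.code_injective N)

instance (N : ℕ) : DecidableEq (LBlock N) := fun a b =>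
  decidable_of_iff (a.code = b.code) (LBlock.code_injective N).eq_iff

/-- Each `L`-block `K` is made of two blocks of the Hessian, of this same size. Hence the Hessian
has two blocks of size `hessSize p K` and `L` has one block of size `2 * hessSize p K`. -/
@[reducible] def hessSize {N : ℕ} : Poles → LBlock N → ℕ
  | _, .zero => 1
  | .absent, .one => 2
  | .two, .one => 3
  | .absent, .bOne => 1
  | .two, .bOne => 2
  | _, .low _ _ => 2
  | _, .low' _ _ => 2
  | _, .half _ => 2

/-- Labels of the basis vectors: the `L`-block, one of its two Hessian blocks, and the position in
this Hessian block. -/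
abbrev SliceIndex (N : ℕ) (p : Poles) : Type :=
  Σ K : LBlock N, Fin 2 × Fin (hessSize p K)

/-- The Hessian block to which a basis vector belongs. -/
def hessBlock {N : ℕ} {p : Poles} (i : SliceIndex N p) : LBlock N × Fin 2 := (i.1, i.2.1)

/-- The basis vectors, listed for every `L`-block as the two lists of vectors that make up its two
Hessian blocks. -/
def blockVectors (N : ℕ) (s : Shape) (θ₀ lam : ℝ) :
    (p : Poles) → (K : LBlock N) → Fin 2 → Fin (hessSize p K) → Ambient N p
  | p, .zero =>
      ![![αθ N s p θ₀ 0],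
        ![αφ' N s p θ₀ 0]]
  | .absent, .one =>
      ![![βφ N s .absent θ₀ 1, αθ' N s .absent θ₀ 1],
        ![αφ N s .absent θ₀ 1, βθ' N s .absent θ₀ 1]]
  | .two, .one =>
      ![![βφ N s .two θ₀ 1, αθ' N s .two θ₀ 1, δxp N],
        ![αφ N s .two θ₀ 1, βθ' N s .two θ₀ 1, δyp N]]
  | .absent, .bOne =>
      ![![Real.sin θ₀ • αθ N s .absent θ₀ 1 + Real.cos θ₀ • βφ' N s .absent θ₀ 1],
        ![Real.sin θ₀ • βθ N s .absent θ₀ 1 - Real.cos θ₀ • αφ' N s .absent θ₀ 1]]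
  | .two, .bOne =>
      ![![Real.sin θ₀ • αθ N s .two θ₀ 1 + Real.cos θ₀ • βφ' N s .two θ₀ 1,
          αθ N s .two θ₀ 1 - (N / (2 * lam) * Real.cos θ₀) • δxp' N],
        ![Real.sin θ₀ • βθ N s .two θ₀ 1 - Real.cos θ₀ • αφ' N s .two θ₀ 1,
          βθ N s .two θ₀ 1 - (N / (2 * lam) * Real.cos θ₀) • δyp' N]]
  | p, .low q _ =>
      ![![αθ N s p θ₀ q, βφ' N s p θ₀ q],
        ![βθ N s p θ₀ q, αφ' N s p θ₀ q]]
  | p, .low' q _ =>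
      ![![αθ' N s p θ₀ q, βφ N s p θ₀ q],
        ![βθ' N s p θ₀ q, αφ N s p θ₀ q]]
  | p, .half _ =>
      match s with
      | .Nd =>
        ![![αθ' N .Nd p θ₀ (N / 2), βφ N .Nd p θ₀ (N / 2)],
          ![βθ' N .Nd p θ₀ (N / 2), αφ N .Nd p θ₀ (N / 2)]]
      | .Nh =>
        ![![αθ N .Nh p θ₀ (N / 2), αθ' N .Nh p θ₀ (N / 2)],
          ![αφ N .Nh p θ₀ (N / 2), αφ' N .Nh p θ₀ (N / 2)]]

/-- The family of basis vectors of the symplectic slice. -/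
def sliceVectors (N : ℕ) (s : Shape) (p : Poles) (θ₀ lam : ℝ) (i : SliceIndex N p) :
    Ambient N p :=
  blockVectors N s θ₀ lam p i.1 i.2.1 i.2.2

/-- The matrix of `d²H_ξ` restricted to the symplectic slice, in the basis `sliceVectors`. -/
def hessianMatrix (N : ℕ) (s : Shape) (p : Poles) (θ₀ lam : ℝ) (ξ : Fin 3 → ℝ) :
    Matrix (SliceIndex N p) (SliceIndex N p) ℝ :=
  Matrix.of fun i j =>
    hessian
      (augmentedHamiltonian lam (momentum lam (configuration N s p θ₀)) ξ)
      (configuration N s p θ₀) (sliceVectors N s p θ₀ lam i) (sliceVectors N s p θ₀ lam j)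

/-- The matrix of `ω` restricted to the symplectic slice, in the basis `sliceVectors`. -/
def omegaMatrix (N : ℕ) (s : Shape) (p : Poles) (θ₀ lam : ℝ) :
    Matrix (SliceIndex N p) (SliceIndex N p) ℝ :=
  Matrix.of fun i j =>
    symplecticForm lam (configuration N s p θ₀)
      (sliceVectors N s p θ₀ lam i) (sliceVectors N s p θ₀ lam j)

/-- The matrix `L = Ω⁻¹ d²H_ξ` of the linearized system in the symplectic slice. -/
def linearizedMatrix (N : ℕ) (s : Shape) (p : Poles) (θ₀ lam : ℝ) (ξ : Fin 3 → ℝ) :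
    Matrix (SliceIndex N p) (SliceIndex N p) ℝ :=
  (omegaMatrix N s p θ₀ lam)⁻¹ * hessianMatrix N s p θ₀ lam ξ

end Slice

end PointVortex

end

/-! The configuration is fixed by three symmetries, each a relabelling of the vortices combined with
an isometry of space preserving the vertical axis: the rotation by `2π/N`, the reflection in a
vertical plane, and the exchange of the two rings. Each multiplies vorticities and the vertical axis
by the same sign `kap`, so `H` is invariant, and so is `⟨Φ, ξ⟩` when `ξ` is vertical. All three
therefore preserve the Hessian of `H_ξ`. They multiply `ω` by `kap * del`, which is `1` for the
rotation and the exchange and `-1` for the reflection.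

Complex characters are avoided by using `T + T⁻¹` for a symmetry `T`. If `T` preserves a bilinear
form, `T + T⁻¹` is self-adjoint for it, and eigenspaces with different eigenvalues are orthogonal
(`bilin_eq_zero_of_symmSum`). A Fourier mode of wave number `q` has eigenvalue `2 cos(2πq/N)` under
the rotation and `±2 cos(qφ₀)` under the exchange. The first separates wave numbers up to `N/2`. The
second separates the two lists of equal wave number, since `cos(qφ₀) ≠ 0` for `2q < N`; for `q =
N/2` there is a single list. This gives the blocks of both forms indexed by whole lists
(`bilin_block_eq_zero`). The two halves of a list are the even and odd vectors under the reflection,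
hence orthogonal for the Hessian. As `ω` changes sign, each half is isotropic for `ω` instead.

Thus `ω` reduces in every list to a pairing of its two halves, and `det_omegaPairing_ne_zero`
computes these pairings by sums of cosines. The Gram matrix of `ω` is then invertible, which also
gives linear independence. Membership in the slice comes from the same symmetries, except for the
horizontal momentum of the modes `q = 1`, which is computed. The vectors span because the normal
directions to the slice bound its dimension by the number of vectors (`finrank_symplecticSlice_le`).

The field `X_H` and the infinitesimal rotation about the axis transform in the same way. Hence the
equilibrium equation need only be verified at one ring vortex and at the poles, where the symmetries
leave no freedom except the angular speed. Finally `L` is a product of two matrices that are block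
diagonal along whole lists. -/

noncomputable section

namespace PointVortex

/-! ### Symmetries of the vortex system and invariance of the Hamiltonian data -/

/-- A relabelling of the vortices together with an isometry of `ℝ³` preserving the vertical axis.
The labels are permuted so that vorticities are multiplied by `kap`, and `kap` is also the factor
by which the isometry acts on the vertical axis; `del` is the determinant of the isometry. -/
structure VortexSymmetry (N : ℕ) (p : Poles) (lam : ℝ) where
  perm : Equiv.Perm (Vortex N p)
  iso : (Fin 3 → ℝ) ≃ₗ[ℝ] (Fin 3 → ℝ)
  kap : ℝ
  del : ℝ
  kap_sq : kap * kap = 1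
  dot_iso : ∀ u v, iso u ⬝ᵥ iso v = u ⬝ᵥ v
  cross_iso : ∀ u v, iso u ⨯₃ iso v = del • iso (u ⨯₃ v)
  vertical_iso : ∀ v, iso v 2 = kap * v 2
  vorticity_perm : ∀ i, vorticity lam (perm i) = kap * vorticity lam i

namespace VortexSymmetry

variable {N : ℕ} {p : Poles} {lam : ℝ} (g : VortexSymmetry N p lam)

/-- The action on `Ambient N p`: `(g v)_{g i} = g (v_i)`. -/
def act : Ambient N p ≃ₗ[ℝ] Ambient N p where
  toFun v i := g.iso (v (g.perm.symm i))
  invFun v i := g.iso.symm (v (g.perm i))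
  map_add' u v := by ext i; simp
  map_smul' c v := by ext i; simp
  left_inv v := by ext i; simp
  right_inv v := by ext i; simp

@[simp] theorem act_apply_perm (v : Ambient N p) (i : Vortex N p) :
    g.act v (g.perm i) = g.iso (v i) := by
  simp [act]

theorem act_eq_iff {v w : Ambient N p} : g.act v = w ↔ ∀ i, g.iso (v i) = w (g.perm i) := by
  constructor
  · rintro rfl i
    simp
  · intro h
    funext i
    obtain ⟨k, rfl⟩ := g.perm.surjective i
    rw [act_apply_perm, h]

theorem radialProjection_act (x : Ambient N p) :
    radialProjection (g.act x) = g.act (radialProjection x) := by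
  symm
  rw [act_eq_iff]
  intro i
  simp [radialProjection, g.dot_iso]

theorem hamiltonian_act (x : Ambient N p) : hamiltonian lam (g.act x) = hamiltonian lam x := by
  unfold hamiltonian
  congr 1
  rw [← Equiv.sum_comp g.perm]
  refine Finset.sum_congr rfl fun i _ => ?_
  rw [← Equiv.sum_comp g.perm]
  refine Finset.sum_congr rfl fun j _ => ?_
  simp only [g.perm.injective.eq_iff, act_apply_perm, ← map_sub, g.dot_iso, g.vorticity_perm]
  split_ifs
  · rfl
  · linear_combination
      (vorticity lam i * vorticity lam j * Real.log ((x i - x j) ⬝ᵥ (x i - x j))) * g.kap_sq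

theorem momentum_act (x : Ambient N p) :
    momentum lam (g.act x) = g.kap • g.iso (momentum lam x) := by
  unfold momentum
  rw [← Equiv.sum_comp g.perm, map_sum, Finset.smul_sum]
  refine Finset.sum_congr rfl fun i _ => ?_
  rw [act_apply_perm, g.vorticity_perm, map_smul, smul_smul]

/-- The vorticities contribute the factor `kap` and the cross products the factor `del`. The same
product `kap * del` governs `ω` and the generator of vertical rotations. -/
theorem vectorField_act (x : Ambient N p) (i : Vortex N p) :
    vectorField lam (g.act x) (g.perm i) = (g.kap * g.del) • g.iso (vectorField lam x i) := by
  unfold vectorField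
  rw [← Equiv.sum_comp g.perm, map_sum, Finset.smul_sum]
  refine Finset.sum_congr rfl fun j _ => ?_
  simp only [g.perm.injective.eq_iff, act_apply_perm, g.dot_iso, g.vorticity_perm, g.cross_iso]
  split_ifs
  · simp
  · rw [map_smul, smul_smul, smul_smul]
    congr 1
    ring

theorem symplecticForm_act (x u v : Ambient N p) :
    symplecticForm lam (g.act x) (g.act u) (g.act v)
      = g.kap * g.del * symplecticForm lam x u v := by
  unfold symplecticForm
  rw [← Equiv.sum_comp g.perm, Finset.mul_sum]
  refine Finset.sum_congr rfl fun i _ => ?_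
  simp only [act_apply_perm, g.vorticity_perm, g.cross_iso, dotProduct_smul, g.dot_iso, smul_eq_mul]
  ring

theorem vertical_dot_iso (c : ℝ) (v : Fin 3 → ℝ) :
    g.iso v ⬝ᵥ ![0, 0, c] = g.kap * (v ⬝ᵥ ![0, 0, c]) := by
  simp [dotProduct, Fin.sum_univ_three, g.vertical_iso]
  ring

/-- The difference of the two sides is orthogonal to the whole image of `iso`, which is all of `ℝ³`,
so it vanishes. -/
theorem iso_vertical (c : ℝ) : g.iso ![0, 0, c] = g.kap • ![0, 0, c] := by
  have h : ∀ w, g.iso w ⬝ᵥ (g.iso ![0, 0, c] - g.kap • ![0, 0, c]) = 0 := by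
    intro w
    rw [dotProduct_sub, g.dot_iso, dotProduct_smul, vertical_dot_iso, smul_eq_mul, ← mul_assoc,
      g.kap_sq, one_mul, sub_self]
  obtain ⟨w, hw⟩ := g.iso.surjective (g.iso ![0, 0, c] - g.kap • ![0, 0, c])
  have := h w
  rw [hw, dotProduct_self_eq_zero] at this
  exact sub_eq_zero.mp this

theorem cross_vertical_iso (c : ℝ) (v : Fin 3 → ℝ) :
    ![0, 0, c] ⨯₃ g.iso v = (g.kap * g.del) • g.iso (![0, 0, c] ⨯₃ v) := by
  have h := g.cross_iso (g.kap • ![0, 0, c]) v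
  rw [map_smul, iso_vertical, smul_smul, g.kap_sq, one_smul] at h
  rw [h, map_smul, LinearMap.smul_apply, map_smul, smul_smul, mul_comm]

theorem generator_act (c : ℝ) (x : Ambient N p) (i : Vortex N p) :
    generator ![0, 0, c] (g.act x) (g.perm i)
      = (g.kap * g.del) • g.iso (generator ![0, 0, c] x i) := by
  simp only [generator, act_apply_perm, cross_vertical_iso]

/-- The momentum brings one factor `kap` and its pairing with a vertical vector another, and `kap *
kap = 1`. This is where `ξ` has to be vertical. -/
theorem augmentedHamiltonian_act (c : ℝ) (μ : Fin 3 → ℝ) (x : Ambient N p) :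
    augmentedHamiltonian lam μ ![0, 0, c] (g.act x)
      = augmentedHamiltonian lam μ ![0, 0, c] x := by
  unfold augmentedHamiltonian
  rw [hamiltonian_act, momentum_act, sub_dotProduct, sub_dotProduct, smul_dotProduct,
    vertical_dot_iso, smul_eq_mul, ← mul_assoc, g.kap_sq, one_mul]

/-- Derivatives commute with composition by linear equivalences even at points of
non-differentiability, so no smoothness of `f` enters. -/
theorem fderiv_fderiv_comp_equiv {E : Type*} [NormedAddCommGroup E] [NormedSpace ℝ E]
    (T : E ≃L[ℝ] E) (f : E → ℝ) (hf : ∀ y, f (T y) = f y) (x u v : E) :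
    fderiv ℝ (fderiv ℝ f) (T x) (T u) (T v) = fderiv ℝ (fderiv ℝ f) x u v := by
  let Λ : (E →L[ℝ] ℝ) ≃L[ℝ] (E →L[ℝ] ℝ) :=
    T.symm.arrowCongr (ContinuousLinearEquiv.refl ℝ ℝ)
  have hΛ : ∀ (l : E →L[ℝ] ℝ) (w : E), Λ l w = l (T w) := fun l w => by simp [Λ]
  have h1 : fderiv ℝ f = Λ ∘ (fderiv ℝ f ∘ T) := by
    funext y
    ext w
    have hfT : f ∘ T = f := funext hf
    conv_lhs => rw [← hfT, T.comp_right_fderiv]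
    simp [hΛ]
  conv_rhs => rw [h1, Λ.comp_fderiv, T.comp_right_fderiv]
  simp [hΛ]

theorem hessian_act (c : ℝ) (μ : Fin 3 → ℝ) (x u v : Ambient N p) :
    hessian (augmentedHamiltonian lam μ ![0, 0, c]) (g.act x) (g.act u) (g.act v)
      = hessian (augmentedHamiltonian lam μ ![0, 0, c]) x u v := by
  unfold hessian
  refine fderiv_fderiv_comp_equiv g.act.toContinuousLinearEquiv
    (fun y => augmentedHamiltonian lam μ ![0, 0, c] (radialProjection y)) (fun y => ?_) x u v
  change augmentedHamiltonian lam μ ![0, 0, c] (radialProjection (g.act y)) = _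
  rw [radialProjection_act, augmentedHamiltonian_act]

end VortexSymmetry

/-! ### Orthogonality of the eigenspaces of `T + T⁻¹` -/

section Eigen

variable {V W : Type*} [AddCommGroup V] [Module ℝ V] [AddCommGroup W] [Module ℝ W]

/-- The endomorphism `T + T⁻¹`. -/
def symmSum (T : V ≃ₗ[ℝ] V) : Module.End ℝ V := T.toLinearMap + T.symm.toLinearMap

theorem mem_eigenspace_symmSum {T : V ≃ₗ[ℝ] V} {c : ℝ} {u : V} :
    u ∈ (symmSum T).eigenspace c ↔ T u + T.symm u = c • u := by
  rw [Module.End.mem_eigenspace_iff]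
  rfl

/-- Invariance gives `B (T u) v = B u (T⁻¹ v)`, so `T + T⁻¹` is self-adjoint for `B`; no symmetry of
`B` is needed, and the lemma serves the Hessian and `ω` alike. -/
theorem bilin_eq_zero_of_symmSum (B : V →ₗ[ℝ] V →ₗ[ℝ] ℝ) (T : V ≃ₗ[ℝ] V)
    (hB : ∀ u v, B (T u) (T v) = B u v) {c d : ℝ} (hcd : c ≠ d) {u v : V}
    (hu : u ∈ (symmSum T).eigenspace c) (hv : v ∈ (symmSum T).eigenspace d) : B u v = 0 := by
  rw [mem_eigenspace_symmSum] at hu hv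
  have h1 : B (T u) v = B u (T.symm v) := by
    conv_lhs => rw [← T.apply_symm_apply v]
    rw [hB]
  have h2 : B (T.symm u) v = B u (T v) := by
    rw [← hB (T.symm u) v, T.apply_symm_apply]
  have h3 : B (T u + T.symm u) v = B u (T v + T.symm v) := by
    rw [map_add, map_add, LinearMap.add_apply, h1, h2, add_comm]
  rw [hu, hv, map_smul, map_smul, LinearMap.smul_apply, smul_eq_mul, smul_eq_mul] at h3
  have h4 : (c - d) * B u v = 0 := by linear_combination h3
  exact (mul_eq_zero.mp h4).resolve_left (sub_ne_zero.mpr hcd)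

/-- Composing an invariant functional with `T + T⁻¹` doubles it, so it can be nonzero only on the
eigenvalue `2`. -/
theorem functional_eq_zero_of_symmSum (F : V →ₗ[ℝ] ℝ) (T : V ≃ₗ[ℝ] V)
    (hF : ∀ u, F (T u) = F u) {c : ℝ} (hc : c ≠ 2) {u : V}
    (hu : u ∈ (symmSum T).eigenspace c) : F u = 0 := by
  rw [mem_eigenspace_symmSum] at hu
  have h1 : F (T.symm u) = F u := by rw [← hF (T.symm u), T.apply_symm_apply]
  have h2 : F (T u + T.symm u) = 2 * F u := by rw [map_add, h1, hF]; ring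
  rw [hu, map_smul, smul_eq_mul] at h2
  have h4 : (c - 2) * F u = 0 := by linear_combination h2
  exact (mul_eq_zero.mp h4).resolve_left (sub_ne_zero.mpr hc)

end Eigen

/-! ### Isometries of space preserving the vertical axis -/

section Isometries

/-- The rotation by `φ` around the vertical axis followed by `diag(1, ε, κ)`. -/
def axisIso (φ ε κ : ℝ) (hε : ε * ε = 1) (hκ : κ * κ = 1) : (Fin 3 → ℝ) ≃ₗ[ℝ] (Fin 3 → ℝ) where
  toFun v := ![Real.cos φ * v 0 - Real.sin φ * v 1,
    ε * (Real.sin φ * v 0 + Real.cos φ * v 1), κ * v 2]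
  invFun v := ![Real.cos φ * v 0 + Real.sin φ * (ε * v 1),
    -Real.sin φ * v 0 + Real.cos φ * (ε * v 1), κ * v 2]
  map_add' u v := by ext i; fin_cases i <;> simp <;> ring
  map_smul' c v := by ext i; fin_cases i <;> simp <;> ring
  left_inv v := by
    have h := Real.cos_sq_add_sin_sq φ
    ext i
    fin_cases i <;> simp
    · linear_combination v 0 * h +
        (Real.sin φ * (Real.sin φ * v 0 + Real.cos φ * v 1)) * hε
    · linear_combination v 1 * h +
        (Real.cos φ * (Real.sin φ * v 0 + Real.cos φ * v 1)) * hε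
    · linear_combination v 2 * hκ
  right_inv v := by
    have h := Real.cos_sq_add_sin_sq φ
    ext i
    fin_cases i <;> simp
    · linear_combination v 0 * h
    · linear_combination (ε * ε * v 1) * h + v 1 * hε
    · linear_combination v 2 * hκ

variable (φ ε κ : ℝ) (hε : ε * ε = 1) (hκ : κ * κ = 1)

theorem axisIso_apply (v : Fin 3 → ℝ) : axisIso φ ε κ hε hκ v =
    ![Real.cos φ * v 0 - Real.sin φ * v 1,
      ε * (Real.sin φ * v 0 + Real.cos φ * v 1), κ * v 2] := rfl

theorem axisIso_symm_apply (v : Fin 3 → ℝ) : (axisIso φ ε κ hε hκ).symm v =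
    ![Real.cos φ * v 0 + Real.sin φ * (ε * v 1),
      -Real.sin φ * v 0 + Real.cos φ * (ε * v 1), κ * v 2] := rfl

theorem axisIso_dot (u v : Fin 3 → ℝ) :
    axisIso φ ε κ hε hκ u ⬝ᵥ axisIso φ ε κ hε hκ v = u ⬝ᵥ v := by
  simp only [axisIso_apply, dotProduct, Fin.sum_univ_three, cons_val]
  linear_combination (u 0 * v 0 + u 1 * v 1) * Real.cos_sq_add_sin_sq φ + u 2 * v 2 * hκ +
    (Real.sin φ * u 0 + Real.cos φ * u 1) * (Real.sin φ * v 0 + Real.cos φ * v 1) * hε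

theorem axisIso_cross (u v : Fin 3 → ℝ) :
    axisIso φ ε κ hε hκ u ⨯₃ axisIso φ ε κ hε hκ v
      = (ε * κ) • axisIso φ ε κ hε hκ (u ⨯₃ v) := by
  have h := Real.cos_sq_add_sin_sq φ
  simp only [axisIso_apply, cross_apply, cons_val, smul_cons, smul_eq_mul, smul_empty]
  ext i
  fin_cases i <;> simp
  · ring
  · linear_combination (-(κ * (Real.sin φ * (u 1 * v 2 - u 2 * v 1)
      + Real.cos φ * (u 2 * v 0 - u 0 * v 2)))) * hε
  · linear_combination (ε * (u 0 * v 1 - u 1 * v 0)) * h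
      - (ε * (u 0 * v 1 - u 1 * v 0)) * hκ

end Isometries

/-! ### Longitudes and cyclic arithmetic of the indices -/

section Longitudes

variable {N : ℕ} [NeZero N]

/-- Addition in `Fin N` wraps modulo `N`, which changes the longitude by a multiple of `2π`,
invisible to a periodic function. -/
theorem periodic_longitude_add {α : Type*} {f : ℝ → α} (hf : Function.Periodic f (2 * Real.pi))
    (j k : Fin N) : f (longitude (j + k)) = f (longitude j + longitude k) := by
  have hN : (N : ℝ) ≠ 0 := Nat.cast_ne_zero.mpr (NeZero.ne N)
  have h1 : ((j + k : Fin N) : ℕ) + N * ((j.val + k.val) / N) = j.val + k.val := by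
    rw [Fin.val_add]
    exact Nat.mod_add_div _ _
  have h2 : ((j + k : Fin N) : ℕ) + (N : ℝ) * (((j.val + k.val) / N : ℕ) : ℝ)
      = (j.val : ℝ) + k.val := by exact_mod_cast h1
  have h3 : longitude j + longitude k
      = longitude (j + k) + (((j.val + k.val) / N : ℕ) : ℝ) * (2 * Real.pi) := by
    unfold longitude
    field_simp
    linear_combination -h2
  rw [h3]
  exact (hf.nat_mul _ _).symm

theorem longitude_zero : longitude (0 : Fin N) = 0 := by simp [longitude]

theorem periodic_longitude_neg {α : Type*} {f : ℝ → α} (hf : Function.Periodic f (2 * Real.pi))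
    (j : Fin N) (c : ℝ) : f (longitude (-j) + c) = f (-longitude j + c) := by
  have hg : Function.Periodic (fun t => f (t - longitude j + c)) (2 * Real.pi) := fun t => by
    have h : t + 2 * Real.pi - longitude j + c = (t - longitude j + c) + 2 * Real.pi := by ring
    simp only [h]
    exact hf _
  have := periodic_longitude_add hg (-j) j
  simp only [neg_add_cancel, longitude_zero, add_sub_cancel_right] at this
  rw [← this]
  congr 1
  ring

/-- The index shift produced by applying twice the symmetry that exchanges the two rings. -/
def ringShift (N : ℕ) [NeZero N] : Shape → Fin N
  | .Nd => 1
  | .Nh => 0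

theorem longitude_one (hN : 3 ≤ N) : longitude (1 : Fin N) = 2 * Real.pi / N := by
  have : ((1 : Fin N) : ℕ) = 1 := by
    rw [Fin.val_one']
    exact Nat.mod_eq_of_lt (by omega)
  rw [longitude, this]
  simp

theorem longitude_ringShift (hN : 3 ≤ N) (s : Shape) :
    longitude (ringShift N s) = 2 * offset N s := by
  cases s
  · rw [ringShift, longitude_one hN, offset]
    ring
  · simp [ringShift, longitude_zero, offset]

end Longitudes

/-! ### The three symmetries, and their action on fields given as functions of longitude -/

section Fields

variable {N : ℕ}

/-- The element of `Ambient N p` given by `F` on the (+)ring and by `G` on the (-)ring, as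
functions of the longitude, and by `P` at the poles. -/
def ringField (N : ℕ) (s : Shape) {p : Poles} (F G : ℝ → Fin 3 → ℝ)
    (P : Fin p.count → Fin 3 → ℝ) : Ambient N p
  | .inl j => F (longitude j)
  | .inr (.inl j) => G (longitude j + offset N s)
  | .inr (.inr k) => P k

theorem ringField_plus (s : Shape) {p : Poles} (F G : ℝ → Fin 3 → ℝ)
    (P : Fin p.count → Fin 3 → ℝ) (j : Fin N) :
    ringField N s F G P (.inl j) = F (longitude j) := rfl

theorem ringField_minus (s : Shape) {p : Poles} (F G : ℝ → Fin 3 → ℝ)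
    (P : Fin p.count → Fin 3 → ℝ) (j : Fin N) :
    ringField N s F G P (.inr (.inl j)) = G (longitude j + offset N s) := rfl

theorem ringField_pole (s : Shape) {p : Poles} (F G : ℝ → Fin 3 → ℝ)
    (P : Fin p.count → Fin 3 → ℝ) (k : Fin p.count) :
    ringField N s F G P (.inr (.inr k)) = P k := rfl

/-- The positions of the poles. -/
def poleField (p : Poles) (u v : Fin 3 → ℝ) (k : Fin p.count) : Fin 3 → ℝ :=
  if k.val = 0 then u else v

theorem configuration_eq (s : Shape) (p : Poles) (θ₀ : ℝ) :
    configuration N s p θ₀ = ringField N s (spherical θ₀) (spherical (Real.pi - θ₀))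
      (poleField p ![0, 0, 1] ![0, 0, -1]) := by
  funext i
  rcases i with j | j | k <;> rfl

theorem axisIso_spherical (φ κ : ℝ) (hε hκ) (θ t : ℝ) :
    axisIso φ 1 κ hε hκ (spherical θ t)
      = ![Real.sin θ * Real.cos (t + φ), Real.sin θ * Real.sin (t + φ), κ * Real.cos θ] := by
  rw [axisIso_apply]
  ext i
  fin_cases i <;> simp [spherical, Real.cos_add, Real.sin_add] <;> ring

theorem spherical_periodic (θ : ℝ) : Function.Periodic (spherical θ) (2 * Real.pi) := by
  intro t
  simp [spherical]

variable [NeZero N]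

/-- The rotation by `2π / N`. -/
def rotation (N : ℕ) [NeZero N] (p : Poles) (lam : ℝ) : VortexSymmetry N p lam where
  perm := Equiv.sumCongr (Equiv.addRight 1) (Equiv.sumCongr (Equiv.addRight 1) (Equiv.refl _))
  iso := axisIso (2 * Real.pi / N) 1 1 (by norm_num) (by norm_num)
  kap := 1
  del := 1
  kap_sq := by norm_num
  dot_iso := axisIso_dot _ _ _ _ _
  cross_iso u v := by rw [axisIso_cross]; norm_num
  vertical_iso v := by simp [axisIso_apply]
  vorticity_perm i := by rcases i with j | j | k <;> simp [vorticity]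

theorem rotation_perm_plus (p : Poles) (lam : ℝ) (j : Fin N) :
    (rotation N p lam).perm (.inl j) = .inl (j + 1) := rfl

theorem rotation_perm_minus (p : Poles) (lam : ℝ) (j : Fin N) :
    (rotation N p lam).perm (.inr (.inl j)) = .inr (.inl (j + 1)) := rfl

theorem rotation_perm_pole (p : Poles) (lam : ℝ) (k : Fin p.count) :
    (rotation N p lam).perm (.inr (.inr k)) = .inr (.inr k) := rfl

/-- The reflection with respect to the vertical plane through the first vortex. -/
def reflection (N : ℕ) [NeZero N] (s : Shape) (p : Poles) (lam : ℝ) : VortexSymmetry N p lam where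
  -- On the (-)ring the longitude `longitude j + φ₀` goes to its opposite, which is `(-longitude j -
  -- 2φ₀) + φ₀`. Since `2φ₀` is the longitude of `ringShift`, the new index is `-ringShift - j`.
  perm := Equiv.sumCongr (Equiv.neg _)
    (Equiv.sumCongr (Equiv.subLeft (-ringShift N s)) (Equiv.refl _))
  iso := axisIso 0 (-1) 1 (by norm_num) (by norm_num)
  kap := 1
  del := -1
  kap_sq := by norm_num
  dot_iso := axisIso_dot _ _ _ _ _
  cross_iso u v := by rw [axisIso_cross, mul_one]
  vertical_iso v := by simp [axisIso_apply]
  vorticity_perm i := by rcases i with j | j | k <;> simp [vorticity]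

theorem reflection_perm_plus (s : Shape) (p : Poles) (lam : ℝ) (j : Fin N) :
    (reflection N s p lam).perm (.inl j) = .inl (-j) := rfl

theorem reflection_perm_minus (s : Shape) (p : Poles) (lam : ℝ) (j : Fin N) :
    (reflection N s p lam).perm (.inr (.inl j)) = .inr (.inl (-ringShift N s - j)) := rfl

/-- The symmetry that exchanges the two rings: rotation by the offset of the rings followed by the
reflection with respect to the equatorial plane. -/
def ringExchange (N : ℕ) [NeZero N] (s : Shape) (p : Poles) (lam : ℝ) :
    VortexSymmetry N p lam where
  perm :=
    { toFun := fun i => match i with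
        | .inl j => .inr (.inl j)
        | .inr (.inl j) => .inl (j + ringShift N s)
        | .inr (.inr k) => .inr (.inr (Fin.rev k))
      invFun := fun i => match i with
        | .inl j => .inr (.inl (j - ringShift N s))
        | .inr (.inl j) => .inl j
        | .inr (.inr k) => .inr (.inr (Fin.rev k))
      left_inv := by intro i; rcases i with j | j | k <;> simp
      right_inv := by intro i; rcases i with j | j | k <;> simp }
  iso := axisIso (offset N s) 1 (-1) (by norm_num) (by norm_num)
  kap := -1
  del := -1
  kap_sq := by norm_num
  dot_iso := axisIso_dot _ _ _ _ _
  cross_iso u v := by rw [axisIso_cross, one_mul]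
  vertical_iso v := by simp [axisIso_apply]
  vorticity_perm i := by
    rcases i with j | j | k
    · simp [vorticity]
    · simp [vorticity]
    · cases p
      · exact k.elim0
      · fin_cases k <;> simp [vorticity, Fin.rev]

theorem ringExchange_perm_minus (s : Shape) (p : Poles) (lam : ℝ) (j : Fin N) :
    (ringExchange N s p lam).perm (.inr (.inl j)) = .inl (j + ringShift N s) := rfl

variable {s : Shape} {p : Poles} {lam : ℝ} {F G F' G' : ℝ → Fin 3 → ℝ}
  {P P' : Fin p.count → Fin 3 → ℝ}

theorem rotation_ringField (hN : 3 ≤ N) (hF' : Function.Periodic F' (2 * Real.pi))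
    (hG' : Function.Periodic G' (2 * Real.pi))
    (hF : ∀ t, (rotation N p lam).iso (F t) = F' (t + 2 * Real.pi / N))
    (hG : ∀ t, (rotation N p lam).iso (G t) = G' (t + 2 * Real.pi / N))
    (hP : ∀ k, (rotation N p lam).iso (P k) = P' k) :
    (rotation N p lam).act (ringField N s F G P) = ringField N s F' G' P' := by
  rw [VortexSymmetry.act_eq_iff]
  rintro (j | j | k)
  · rw [ringField_plus, rotation_perm_plus, ringField_plus, periodic_longitude_add hF', longitude_one hN]
    exact hF _
  · have h1 : G' (longitude (j + 1) + offset N s) = G' (longitude j + longitude 1 + offset N s) :=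
      periodic_longitude_add (hG'.add_const (offset N s)) j 1
    rw [ringField_minus, rotation_perm_minus, ringField_minus, h1, longitude_one hN, add_right_comm]
    exact hG _
  · exact hP k

theorem reflection_ringField (hN : 3 ≤ N) (hF' : Function.Periodic F' (2 * Real.pi))
    (hG' : Function.Periodic G' (2 * Real.pi))
    (hF : ∀ t, (reflection N s p lam).iso (F t) = F' (-t))
    (hG : ∀ t, (reflection N s p lam).iso (G t) = G' (-t))
    (hP : ∀ k, (reflection N s p lam).iso (P k) = P' k) :
    (reflection N s p lam).act (ringField N s F G P) = ringField N s F' G' P' := by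
  rw [VortexSymmetry.act_eq_iff]
  rintro (j | j | k)
  · have h1 := periodic_longitude_neg hF' j 0
    rw [add_zero, add_zero] at h1
    rw [ringField_plus, reflection_perm_plus, ringField_plus, h1]
    exact hF _
  · have h1 := periodic_longitude_neg hG' (ringShift N s + j) (offset N s)
    have h2 : Function.Periodic (fun t => G' (-t + offset N s)) (2 * Real.pi) := fun t => by
      have h : -(t + 2 * Real.pi) + offset N s = (-t + offset N s) - 2 * Real.pi := by ring
      simp only [h]
      exact hG'.sub_eq _
    have h3 : G' (-longitude (ringShift N s + j) + offset N s)
        = G' (-(longitude (ringShift N s) + longitude j) + offset N s) :=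
      periodic_longitude_add h2 (ringShift N s) j
    rw [ringField_minus, reflection_perm_minus, ringField_minus, ← neg_add', h1, h3, longitude_ringShift hN]
    refine (hG _).trans (congrArg G' ?_)
    ring
  · exact hP k

theorem ringExchange_ringField (hN : 3 ≤ N) (hF' : Function.Periodic F' (2 * Real.pi))
    (hF : ∀ t, (ringExchange N s p lam).iso (F t) = G' (t + offset N s))
    (hG : ∀ t, (ringExchange N s p lam).iso (G t) = F' (t + offset N s))
    (hP : ∀ k, (ringExchange N s p lam).iso (P k) = P' (Fin.rev k)) :
    (ringExchange N s p lam).act (ringField N s F G P) = ringField N s F' G' P' := by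
  rw [VortexSymmetry.act_eq_iff]
  rintro (j | j | k)
  · exact hF _
  · rw [ringField_minus, ringExchange_perm_minus, ringField_plus, periodic_longitude_add hF', longitude_ringShift hN]
    refine (hG _).trans (congrArg F' ?_)
    ring
  · exact hP k

theorem rotation_configuration (hN : 3 ≤ N) (s : Shape) (p : Poles) (lam θ₀ : ℝ) :
    (rotation N p lam).act (configuration N s p θ₀) = configuration N s p θ₀ := by
  rw [configuration_eq]
  refine rotation_ringField hN (spherical_periodic _) (spherical_periodic _) (fun t => ?_)
    (fun t => ?_) (fun k => ?_)
  · exact (axisIso_spherical _ _ (by norm_num) (by norm_num) _ _).trans (by simp [spherical])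
  · exact (axisIso_spherical _ _ (by norm_num) (by norm_num) _ _).trans (by simp [spherical])
  · unfold poleField
    split_ifs <;> simp [rotation, axisIso_apply]

theorem reflection_configuration (hN : 3 ≤ N) (s : Shape) (p : Poles) (lam θ₀ : ℝ) :
    (reflection N s p lam).act (configuration N s p θ₀) = configuration N s p θ₀ := by
  rw [configuration_eq]
  refine reflection_ringField hN (spherical_periodic _) (spherical_periodic _) (fun t => ?_)
    (fun t => ?_) (fun k => ?_)
  · simp [reflection, axisIso_apply, spherical]
  · simp [reflection, axisIso_apply, spherical]
  · unfold poleField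
    split_ifs <;> simp [reflection, axisIso_apply]

theorem ringExchange_configuration (hN : 3 ≤ N) (s : Shape) (p : Poles) (lam θ₀ : ℝ) :
    (ringExchange N s p lam).act (configuration N s p θ₀) = configuration N s p θ₀ := by
  rw [configuration_eq]
  refine ringExchange_ringField hN (spherical_periodic _) (fun t => ?_)
    (fun t => ?_) (fun k => ?_)
  · exact (axisIso_spherical _ _ (by norm_num) (by norm_num) _ _).trans (by simp [spherical])
  · exact (axisIso_spherical _ _ (by norm_num) (by norm_num) _ _).trans (by simp [spherical])
  · cases p
    · exact k.elim0
    · fin_cases k <;> simp [poleField, ringExchange, axisIso_apply, Fin.rev]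

end Fields

/-! ### Fourier modes as eigenvectors of the symmetries -/

section Modes

variable {N : ℕ}

/-- A vector field on the sphere that is invariant under rotations around the vertical axis, that
the reflection `z ↦ -z` multiplies by `η` and that the reflection `y ↦ -y` multiplies by `χ`. -/
structure SymmetricFrame (w : ℝ → ℝ → Fin 3 → ℝ) (η χ : ℝ) : Prop where
  periodic : ∀ θ, Function.Periodic (w θ) (2 * Real.pi)
  rot : ∀ φ hε hκ θ t, axisIso φ 1 1 hε hκ (w θ t) = w θ (t + φ)
  exch : ∀ φ hε hκ θ t, axisIso φ 1 (-1) hε hκ (w θ t) = η • w (Real.pi - θ) (t + φ)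
  refl : ∀ hε hκ θ t, axisIso 0 (-1) 1 hε hκ (w θ t) = χ • w θ (-t)

theorem symmetricFrame_theta : SymmetricFrame dSphericalTheta (-1) 1 where
  periodic θ t := by simp [dSphericalTheta]
  rot φ hε hκ θ t := by
    rw [axisIso_apply]
    ext i
    fin_cases i <;> simp [dSphericalTheta, Real.cos_add, Real.sin_add] <;> ring
  exch φ hε hκ θ t := by
    rw [axisIso_apply]
    ext i
    fin_cases i <;> simp [dSphericalTheta, Real.cos_add, Real.sin_add] <;> ring
  refl hε hκ θ t := by
    rw [axisIso_apply]
    ext i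
    fin_cases i <;> simp [dSphericalTheta]

theorem symmetricFrame_phi : SymmetricFrame dSphericalPhi 1 (-1) where
  periodic θ t := by simp [dSphericalPhi]
  rot φ hε hκ θ t := by
    rw [axisIso_apply]
    ext i
    fin_cases i <;> simp [dSphericalPhi, Real.cos_add, Real.sin_add] <;> ring
  exch φ hε hκ θ t := by
    rw [axisIso_apply]
    ext i
    fin_cases i <;> simp [dSphericalPhi, Real.cos_add, Real.sin_add] <;> ring
  refl hε hκ θ t := by
    rw [axisIso_apply]
    ext i
    fin_cases i <;> simp [dSphericalPhi]

/-- The Fourier mode of wave number `q` and phase `ψ` in the direction `w`, with relative sign `ε`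
between the two rings. -/
def ringMode (N : ℕ) (s : Shape) (p : Poles) (θ₀ : ℝ) (w : ℝ → ℝ → Fin 3 → ℝ) (q : ℕ) (ε ψ : ℝ) :
    Ambient N p :=
  ringField N s (fun t => Real.cos (q * t - ψ) • w θ₀ t)
    (fun t => (ε * Real.cos (q * t - ψ)) • w (Real.pi - θ₀) t) 0

/-- The vector in the direction `ψ` at the North pole and `ε` times this vector at the South
pole. -/
def poleMode (N : ℕ) (s : Shape) (ε ψ : ℝ) : Ambient N .two :=
  ringField N s 0 0 (poleField .two ![Real.cos ψ, Real.sin ψ, 0]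
    (ε • ![Real.cos ψ, Real.sin ψ, 0]))

/-- Phase `0` gives the real part and phase `π/2` the imaginary part, so the vectors `α` and `β`
belong to one family in which the rotation and the exchange act by shifting the phase, up to sign.
-/
theorem modeRe_eq (s : Shape) (p : Poles) (θ₀ : ℝ) (w : ℝ → ℝ → Fin 3 → ℝ) (q : ℕ) (ε : ℝ) :
    modeRe N s p q ε (fun j => Pi.single (.inl j) (w θ₀ (longitude j)))
      (fun j => Pi.single (.inr (.inl j)) (w (Real.pi - θ₀) (longitude j + offset N s)))
      = ringMode N s p θ₀ w q ε 0 := by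
  funext i
  rcases i with j | j | k <;>
    simp [modeRe, ringMode, ringField, Finset.sum_apply, Pi.single_apply]

theorem modeIm_eq (s : Shape) (p : Poles) (θ₀ : ℝ) (w : ℝ → ℝ → Fin 3 → ℝ) (q : ℕ) (ε : ℝ) :
    modeIm N s p q ε (fun j => Pi.single (.inl j) (w θ₀ (longitude j)))
      (fun j => Pi.single (.inr (.inl j)) (w (Real.pi - θ₀) (longitude j + offset N s)))
      = ringMode N s p θ₀ w q ε (Real.pi / 2) := by
  funext i
  rcases i with j | j | k <;>
    simp [modeIm, ringMode, ringField, Finset.sum_apply, Pi.single_apply,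
      Real.cos_sub_pi_div_two]

section Names

variable (s : Shape) (p : Poles) (θ₀ : ℝ) (q : ℕ)

theorem αθ_eq : αθ N s p θ₀ q = ringMode N s p θ₀ dSphericalTheta q 1 0 := modeRe_eq ..
theorem αθ'_eq : αθ' N s p θ₀ q = ringMode N s p θ₀ dSphericalTheta q (-1) 0 := modeRe_eq ..
theorem αφ_eq : αφ N s p θ₀ q = ringMode N s p θ₀ dSphericalPhi q 1 0 := modeRe_eq ..
theorem αφ'_eq : αφ' N s p θ₀ q = ringMode N s p θ₀ dSphericalPhi q (-1) 0 := modeRe_eq ..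
theorem βθ_eq : βθ N s p θ₀ q = ringMode N s p θ₀ dSphericalTheta q 1 (Real.pi / 2) :=
  modeIm_eq ..
theorem βθ'_eq : βθ' N s p θ₀ q = ringMode N s p θ₀ dSphericalTheta q (-1) (Real.pi / 2) :=
  modeIm_eq ..
theorem βφ_eq : βφ N s p θ₀ q = ringMode N s p θ₀ dSphericalPhi q 1 (Real.pi / 2) :=
  modeIm_eq ..
theorem βφ'_eq : βφ' N s p θ₀ q = ringMode N s p θ₀ dSphericalPhi q (-1) (Real.pi / 2) :=
  modeIm_eq ..

theorem polar_eq (ε ψ : ℝ) :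
    polar N ε ![Real.cos ψ, Real.sin ψ, 0] = poleMode N s ε ψ := by
  funext i
  rcases i with j | j | k
  · simp [polar, poleMode, ringField]
  · simp [polar, poleMode, ringField]
  · fin_cases k <;> simp [polar, poleMode, ringField, poleField]

theorem δxp_eq : δxp N = poleMode N s 1 0 := by rw [← polar_eq]; simp [δxp]
theorem δxp'_eq : δxp' N = poleMode N s (-1) 0 := by rw [← polar_eq]; simp [δxp']
theorem δyp_eq : δyp N = poleMode N s 1 (Real.pi / 2) := by rw [← polar_eq]; simp [δyp]
theorem δyp'_eq : δyp' N = poleMode N s (-1) (Real.pi / 2) := by rw [← polar_eq]; simp [δyp']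

end Names

theorem ringMode_add_sub (s : Shape) (p : Poles) (θ₀ : ℝ) (w : ℝ → ℝ → Fin 3 → ℝ) (q : ℕ)
    (ε ψ x : ℝ) : ringMode N s p θ₀ w q ε (ψ + x) + ringMode N s p θ₀ w q ε (ψ - x)
      = (2 * Real.cos x) • ringMode N s p θ₀ w q ε ψ := by
  have h : ∀ t : ℝ, Real.cos (q * t - (ψ + x)) + Real.cos (q * t - (ψ - x))
      = 2 * Real.cos x * Real.cos (q * t - ψ) := fun t => by
    rw [← sub_sub, ← sub_add, Real.cos_sub (q * t - ψ), Real.cos_add (q * t - ψ)]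
    ring
  funext i
  rcases i with j | j | k
  · simp only [ringMode, Pi.add_apply, Pi.smul_apply, ringField_plus, ← add_smul, smul_smul, h]
  · simp only [ringMode, Pi.add_apply, Pi.smul_apply, ringField_minus, ← add_smul, smul_smul,
      ← mul_add, h]
    congr 1
    ring
  · simp [ringMode, ringField_pole]

theorem poleMode_add_sub (s : Shape) (ε ψ x : ℝ) :
    poleMode N s ε (ψ + x) + poleMode N s ε (ψ - x)
      = (2 * Real.cos x) • poleMode N s ε ψ := by
  funext i
  rcases i with j | j | k
  · simp [poleMode, ringField]
  · simp [poleMode, ringField]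
  · simp only [poleMode, Pi.add_apply, Pi.smul_apply, ringField, poleField]
    split_ifs <;> ext m <;> fin_cases m <;>
      simp [Real.cos_add, Real.sin_add, Real.cos_sub, Real.sin_sub] <;> ring

theorem periodic_cos_smul {f : ℝ → Fin 3 → ℝ} (hf : Function.Periodic f (2 * Real.pi)) (q : ℕ)
    (c ψ : ℝ) : Function.Periodic (fun t => (c * Real.cos (q * t - ψ)) • f t) (2 * Real.pi) := by
  intro t
  have h : (q : ℝ) * (t + 2 * Real.pi) - ψ = (q * t - ψ) + q * (2 * Real.pi) := by ring
  simp only [h, Real.cos_add_nat_mul_two_pi, hf t]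

theorem periodic_cos_smul_one {f : ℝ → Fin 3 → ℝ} (hf : Function.Periodic f (2 * Real.pi)) (q : ℕ)
    (ψ : ℝ) : Function.Periodic (fun t => Real.cos (q * t - ψ) • f t) (2 * Real.pi) := by
  simpa using periodic_cos_smul hf q 1 ψ

theorem periodic_smul {f : ℝ → Fin 3 → ℝ} {T : ℝ} (hf : Function.Periodic f T) (c : ℝ) :
    Function.Periodic (c • f) T := fun t => by rw [Pi.smul_apply, hf t, Pi.smul_apply]

theorem smul_ringField (s : Shape) {p : Poles} (c : ℝ) (F G : ℝ → Fin 3 → ℝ)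
    (P : Fin p.count → Fin 3 → ℝ) :
    c • ringField N s F G P = ringField N s (c • F) (c • G) (c • P) := by
  funext i
  rcases i with j | j | k <;> rfl

variable [NeZero N] {w : ℝ → ℝ → Fin 3 → ℝ} {η χ : ℝ}

theorem rotation_ringMode (hN : 3 ≤ N) (hw : SymmetricFrame w η χ) (s : Shape) (p : Poles)
    (lam θ₀ : ℝ) (q : ℕ) (ε ψ : ℝ) :
    (rotation N p lam).act (ringMode N s p θ₀ w q ε ψ)
      = ringMode N s p θ₀ w q ε (ψ + q * (2 * Real.pi / N)) := by
  have h : ∀ t : ℝ, q * (t + 2 * Real.pi / N) - (ψ + q * (2 * Real.pi / N)) = q * t - ψ :=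
    fun t => by ring
  refine rotation_ringField hN (periodic_cos_smul_one (hw.periodic _) _ _)
    (periodic_cos_smul (hw.periodic _) _ _ _) (fun t => ?_) (fun t => ?_) (fun k => map_zero _)
  · rw [map_smul, h]
    exact congrArg _ (hw.rot _ (by norm_num) (by norm_num) _ _)
  · rw [map_smul, h]
    exact congrArg _ (hw.rot _ (by norm_num) (by norm_num) _ _)

theorem reflection_ringMode (hN : 3 ≤ N) (hw : SymmetricFrame w η χ) (s : Shape) (p : Poles)
    (lam θ₀ : ℝ) (q : ℕ) (ε ψ : ℝ) :
    (reflection N s p lam).act (ringMode N s p θ₀ w q ε ψ)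
      = χ • ringMode N s p θ₀ w q ε (-ψ) := by
  have h : ∀ t : ℝ, Real.cos (q * (-t) - -ψ) = Real.cos (q * t - ψ) := fun t => by
    rw [← Real.cos_neg]
    congr 1
    ring
  unfold ringMode
  rw [smul_ringField]
  refine reflection_ringField hN ?_ ?_ (fun t => ?_) (fun t => ?_) (fun k => ?_)
  · exact periodic_smul (periodic_cos_smul_one (hw.periodic _) _ _) _
  · exact periodic_smul (periodic_cos_smul (hw.periodic _) _ _ _) _
  · rw [map_smul, Pi.smul_apply, h, smul_comm]
    exact congrArg _ (hw.refl (by norm_num) (by norm_num) _ _)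
  · rw [map_smul, Pi.smul_apply, h, smul_comm]
    exact congrArg _ (hw.refl (by norm_num) (by norm_num) _ _)
  · simp

theorem ringExchange_ringMode (hN : 3 ≤ N) (hw : SymmetricFrame w η χ) (s : Shape) (p : Poles)
    (lam θ₀ : ℝ) (q : ℕ) {ε : ℝ} (hε : ε * ε = 1) (ψ : ℝ) :
    (ringExchange N s p lam).act (ringMode N s p θ₀ w q ε ψ)
      = (η * ε) • ringMode N s p θ₀ w q ε (ψ + q * offset N s) := by
  have h : ∀ t : ℝ, q * (t + offset N s) - (ψ + q * offset N s) = q * t - ψ :=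
    fun t => by ring
  unfold ringMode
  rw [smul_ringField]
  refine ringExchange_ringField hN ?_ (fun t => ?_) (fun t => ?_) (fun k => ?_)
  · exact periodic_smul (periodic_cos_smul_one (hw.periodic _) _ _) _
  · rw [map_smul, Pi.smul_apply, h]
    refine (congrArg _ (hw.exch _ (by norm_num) (by norm_num) _ _)).trans ?_
    rw [smul_smul, smul_smul]
    congr 1
    -- The field now read on the (-)ring came from the (+)ring and lacks the factor `ε`; it is
    -- recovered from `ε * ε = 1`.
    linear_combination (-(η * Real.cos (q * t - ψ))) * hε
  · rw [map_smul, Pi.smul_apply, h]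
    refine (congrArg _ (hw.exch _ (by norm_num) (by norm_num) _ _)).trans ?_
    rw [smul_smul, smul_smul, sub_sub_cancel]
    congr 1
    ring
  · simp

theorem rotation_poleMode (hN : 3 ≤ N) (s : Shape) (lam ε ψ : ℝ) :
    (rotation N .two lam).act (poleMode N s ε ψ) = poleMode N s ε (ψ + 2 * Real.pi / N) := by
  refine rotation_ringField hN (fun _ => rfl) (fun _ => rfl) (fun t => map_zero _)
    (fun t => map_zero _) (fun k => ?_)
  unfold poleField
  split_ifs <;> ext m <;> fin_cases m <;>
    simp [rotation, axisIso_apply, Real.cos_add, Real.sin_add] <;> ring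

theorem reflection_poleMode (hN : 3 ≤ N) (s : Shape) (lam ε ψ : ℝ) :
    (reflection N s .two lam).act (poleMode N s ε ψ) = poleMode N s ε (-ψ) := by
  refine reflection_ringField hN (fun _ => rfl) (fun _ => rfl) (fun t => map_zero _)
    (fun t => map_zero _) (fun k => ?_)
  unfold poleField
  split_ifs <;> ext m <;> fin_cases m <;> simp [reflection, axisIso_apply]

theorem ringExchange_poleMode (hN : 3 ≤ N) (s : Shape) (lam : ℝ) {ε : ℝ} (hε : ε * ε = 1)
    (ψ : ℝ) : (ringExchange N s .two lam).act (poleMode N s ε ψ)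
      = ε • poleMode N s ε (ψ + offset N s) := by
  unfold poleMode
  rw [smul_ringField]
  refine ringExchange_ringField hN (fun _ => ?_) (fun t => ?_)
    (fun t => ?_) (fun k => ?_)
  · simp
  · simp
  · simp
  · fin_cases k <;> ext m <;> fin_cases m <;>
      simp [poleField, ringExchange, axisIso_apply, Fin.rev, Real.cos_add, Real.sin_add] <;>
      first
        | ring1
        | linear_combination (-(Real.cos ψ * Real.cos (offset N s)
            - Real.sin ψ * Real.sin (offset N s))) * hε
        | linear_combination (-(Real.cos ψ * Real.sin (offset N s)
            + Real.sin ψ * Real.cos (offset N s))) * hε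

/-- When `T` shifts the phase by `x` up to a sign `c`, its inverse shifts by `-x` with the same
sign, and the sum of the two shifts is the scalar `2 cos x` on every phase. -/
theorem mem_eigenspace_symmSum_of_shift {V : Type*} [AddCommGroup V] [Module ℝ V]
    {T : V ≃ₗ[ℝ] V} {c x : ℝ} (hc : c * c = 1) {m : ℝ → V}
    (hT : ∀ ψ, T (m ψ) = c • m (ψ + x))
    (hm : ∀ ψ, m (ψ + x) + m (ψ - x) = (2 * Real.cos x) • m ψ) (ψ : ℝ) :
    m ψ ∈ (symmSum T).eigenspace (c * (2 * Real.cos x)) := by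
  have h : T.symm (m ψ) = c • m (ψ - x) := by
    rw [LinearEquiv.symm_apply_eq, map_smul, hT, smul_smul, hc, one_smul, sub_add_cancel]
  rw [mem_eigenspace_symmSum, hT, h, ← smul_add, hm, smul_smul]

variable (N) in
/-- The elements of `Ambient N p` of wave number `q` under the cyclic symmetry of the rings. -/
def waveSpace (p : Poles) (lam : ℝ) (q : ℕ) : Submodule ℝ (Ambient N p) :=
  (symmSum (rotation N p lam).act).eigenspace (2 * Real.cos (q * (2 * Real.pi / N)))

variable (N) in
/-- The elements of `Ambient N p` of parity `d` and wave number `q` under the symmetry that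
exchanges the rings. -/
def exchangeSpace (s : Shape) (p : Poles) (lam d : ℝ) (q : ℕ) : Submodule ℝ (Ambient N p) :=
  (symmSum (ringExchange N s p lam).act).eigenspace (d * (2 * Real.cos (q * offset N s)))

variable (N) in
/-- The elements of `Ambient N p` of parity `d` under the reflection. -/
def reflectionSpace (s : Shape) (p : Poles) (lam d : ℝ) : Submodule ℝ (Ambient N p) :=
  Module.End.eigenspace (reflection N s p lam).act.toLinearMap d

theorem mem_reflectionSpace {s : Shape} {p : Poles} {lam d : ℝ} {u : Ambient N p} :
    u ∈ reflectionSpace N s p lam d ↔ (reflection N s p lam).act u = d • u :=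
  Module.End.mem_eigenspace_iff

theorem ringMode_mem_waveSpace (hN : 3 ≤ N) (hw : SymmetricFrame w η χ) (s : Shape) (p : Poles)
    (lam θ₀ : ℝ) (q : ℕ) (ε ψ : ℝ) : ringMode N s p θ₀ w q ε ψ ∈ waveSpace N p lam q := by
  have := mem_eigenspace_symmSum_of_shift (T := (rotation N p lam).act) (c := 1)
    (x := q * (2 * Real.pi / N)) (m := ringMode N s p θ₀ w q ε) (by norm_num)
    (fun ψ => by rw [rotation_ringMode hN hw, one_smul]) (fun ψ => ringMode_add_sub ..) ψ
  rwa [one_mul] at this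

theorem poleMode_mem_waveSpace (hN : 3 ≤ N) (s : Shape) (lam ε ψ : ℝ) :
    poleMode N s ε ψ ∈ waveSpace N .two lam 1 := by
  have := mem_eigenspace_symmSum_of_shift (T := (rotation N .two lam).act) (c := 1)
    (x := 2 * Real.pi / N) (m := poleMode N s ε) (by norm_num)
    (fun ψ => by rw [rotation_poleMode hN, one_smul]) (fun ψ => poleMode_add_sub ..) ψ
  rw [one_mul] at this
  rwa [waveSpace, Nat.cast_one, one_mul]

theorem ringMode_mem_exchangeSpace (hN : 3 ≤ N) (hw : SymmetricFrame w η χ) (hη : η * η = 1)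
    (s : Shape) (p : Poles) (lam θ₀ : ℝ) (q : ℕ) {ε : ℝ} (hε : ε * ε = 1) (ψ : ℝ) :
    ringMode N s p θ₀ w q ε ψ ∈ exchangeSpace N s p lam (η * ε) q :=
  mem_eigenspace_symmSum_of_shift (by linear_combination hη + η * η * hε)
    (fun ψ => ringExchange_ringMode hN hw _ _ _ _ _ hε ψ) (fun ψ => ringMode_add_sub ..) ψ

theorem poleMode_mem_exchangeSpace (hN : 3 ≤ N) (s : Shape) (lam : ℝ) {ε : ℝ} (hε : ε * ε = 1)
    (ψ : ℝ) : poleMode N s ε ψ ∈ exchangeSpace N s .two lam ε 1 := by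
  have := mem_eigenspace_symmSum_of_shift hε
    (fun ψ => ringExchange_poleMode hN s lam hε ψ) (fun ψ => poleMode_add_sub ..) ψ
  rwa [exchangeSpace, Nat.cast_one, one_mul]

theorem ringMode_zero_mem_reflectionSpace (hN : 3 ≤ N) (hw : SymmetricFrame w η χ) (s : Shape)
    (p : Poles) (lam θ₀ : ℝ) (q : ℕ) (ε : ℝ) :
    ringMode N s p θ₀ w q ε 0 ∈ reflectionSpace N s p lam χ := by
  rw [mem_reflectionSpace, reflection_ringMode hN hw, neg_zero]

theorem ringMode_pi_div_two_mem_reflectionSpace (hN : 3 ≤ N) (hw : SymmetricFrame w η χ)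
    (s : Shape) (p : Poles) (lam θ₀ : ℝ) (q : ℕ) (ε : ℝ) :
    ringMode N s p θ₀ w q ε (Real.pi / 2) ∈ reflectionSpace N s p lam (-χ) := by
  -- Reflection turns the phase `π/2` into `-π/2`, which is the opposite mode; hence the sign `-χ`.
  have h : ∀ t, Real.cos (t + Real.pi / 2) = -Real.cos (t - Real.pi / 2) := fun t => by
    rw [Real.cos_add_pi_div_two, Real.cos_sub_pi_div_two]
  rw [mem_reflectionSpace, reflection_ringMode hN hw, neg_smul, ← smul_neg]
  congr 1
  funext i
  rcases i with j | j | k <;> simp [ringMode, ringField, h]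

theorem poleMode_zero_mem_reflectionSpace (hN : 3 ≤ N) (s : Shape) (lam ε : ℝ) :
    poleMode N s ε 0 ∈ reflectionSpace N s .two lam 1 := by
  rw [mem_reflectionSpace, reflection_poleMode hN, neg_zero, one_smul]

theorem poleMode_pi_div_two_mem_reflectionSpace (hN : 3 ≤ N) (s : Shape) (lam ε : ℝ) :
    poleMode N s ε (Real.pi / 2) ∈ reflectionSpace N s .two lam (-1) := by
  rw [mem_reflectionSpace, reflection_poleMode hN]
  funext i
  rcases i with j | j | k
  · simp [poleMode, ringField]
  · simp [poleMode, ringField]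
  · fin_cases k <;> simp [poleMode, ringField, poleField]

end Modes

/-! ### Symmetry types of the basis vectors -/

section BlockTypes

variable {N : ℕ}

/-- The wave number of the vectors of a block. -/
def LBlock.waveNumber : LBlock N → ℕ
  | .zero => 0
  | .one => 1
  | .bOne => 1
  | .low q _ => q
  | .low' q _ => q
  | .half _ => N / 2

/-- The parity of the vectors of a block under the exchange of the rings (irrelevant for the mode
`N / 2`). -/
def LBlock.parity : LBlock N → ℝ
  | .zero => -1
  | .one => 1
  | .bOne => -1
  | .low _ _ => -1
  | .low' _ _ => 1
  | .half _ => 1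

theorem forall_fin_three {P : Fin 3 → Prop} : (∀ i, P i) ↔ P 0 ∧ P 1 ∧ P 2 := by
  simp [Fin.forall_fin_succ]

/-- A submodule containing all modes of the wave number of the block contains its vectors, which are
linear combinations of them. Applied both to eigenspaces and to the tangent space. -/
theorem blockVectors_mem (s : Shape) (θ₀ lam : ℝ) (M : ∀ p, Submodule ℝ (Ambient N p))
    (K : LBlock N)
    (hθ : ∀ p ε ψ, ringMode N s p θ₀ dSphericalTheta K.waveNumber ε ψ ∈ M p)
    (hφ : ∀ p ε ψ, ringMode N s p θ₀ dSphericalPhi K.waveNumber ε ψ ∈ M p)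
    (hP : K.waveNumber = 1 → ∀ ε ψ, poleMode N s ε ψ ∈ M .two) (p : Poles) :
    ∀ (b : Fin 2) (a : Fin (hessSize p K)), blockVectors N s θ₀ lam p K b a ∈ M p := by
  have h1 : αθ N s p θ₀ K.waveNumber ∈ M p := by rw [αθ_eq]; exact hθ _ _ _
  have h2 : αθ' N s p θ₀ K.waveNumber ∈ M p := by rw [αθ'_eq]; exact hθ _ _ _
  have h3 : αφ N s p θ₀ K.waveNumber ∈ M p := by rw [αφ_eq]; exact hφ _ _ _
  have h4 : αφ' N s p θ₀ K.waveNumber ∈ M p := by rw [αφ'_eq]; exact hφ _ _ _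
  have h5 : βθ N s p θ₀ K.waveNumber ∈ M p := by rw [βθ_eq]; exact hθ _ _ _
  have h6 : βθ' N s p θ₀ K.waveNumber ∈ M p := by rw [βθ'_eq]; exact hθ _ _ _
  have h7 : βφ N s p θ₀ K.waveNumber ∈ M p := by rw [βφ_eq]; exact hφ _ _ _
  have h8 : βφ' N s p θ₀ K.waveNumber ∈ M p := by rw [βφ'_eq]; exact hφ _ _ _
  have k1 : K.waveNumber = 1 → δxp N ∈ M .two := fun h => by
    rw [δxp_eq s]; exact hP h _ _
  have k2 : K.waveNumber = 1 → δyp N ∈ M .two := fun h => by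
    rw [δyp_eq s]; exact hP h _ _
  have k3 : K.waveNumber = 1 → δxp' N ∈ M .two := fun h => by
    rw [δxp'_eq s]; exact hP h _ _
  have k4 : K.waveNumber = 1 → δyp' N ∈ M .two := fun h => by
    rw [δyp'_eq s]; exact hP h _ _
  have sm := fun (c : ℝ) {u : Ambient N p} (hu : u ∈ M p) => Submodule.smul_mem _ c hu
  cases K with
  | zero =>
    cases p <;> exact Fin.forall_fin_two.mpr
      ⟨Fin.forall_fin_one.mpr h1, Fin.forall_fin_one.mpr h4⟩
  | one =>
    cases p
    · exact Fin.forall_fin_two.mpr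
        ⟨Fin.forall_fin_two.mpr ⟨h7, h2⟩, Fin.forall_fin_two.mpr ⟨h3, h6⟩⟩
    · exact Fin.forall_fin_two.mpr
        ⟨forall_fin_three.mpr ⟨h7, h2, k1 rfl⟩, forall_fin_three.mpr ⟨h3, h6, k2 rfl⟩⟩
  | bOne =>
    cases p
    · exact Fin.forall_fin_two.mpr
        ⟨Fin.forall_fin_one.mpr (add_mem (sm _ h1) (sm _ h8)),
          Fin.forall_fin_one.mpr (sub_mem (sm _ h5) (sm _ h4))⟩
    · exact Fin.forall_fin_two.mpr
        ⟨Fin.forall_fin_two.mpr ⟨add_mem (sm _ h1) (sm _ h8), sub_mem h1 (sm _ (k3 rfl))⟩,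
          Fin.forall_fin_two.mpr ⟨sub_mem (sm _ h5) (sm _ h4), sub_mem h5 (sm _ (k4 rfl))⟩⟩
  | low q hq =>
    cases p <;> exact Fin.forall_fin_two.mpr
      ⟨Fin.forall_fin_two.mpr ⟨h1, h8⟩, Fin.forall_fin_two.mpr ⟨h5, h4⟩⟩
  | low' q hq =>
    cases p <;> exact Fin.forall_fin_two.mpr
      ⟨Fin.forall_fin_two.mpr ⟨h2, h7⟩, Fin.forall_fin_two.mpr ⟨h6, h3⟩⟩
  | half hN =>
    cases s
    · cases p <;> exact Fin.forall_fin_two.mpr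
        ⟨Fin.forall_fin_two.mpr ⟨h2, h7⟩, Fin.forall_fin_two.mpr ⟨h6, h3⟩⟩
    · cases p <;> exact Fin.forall_fin_two.mpr
        ⟨Fin.forall_fin_two.mpr ⟨h1, h2⟩, Fin.forall_fin_two.mpr ⟨h3, h4⟩⟩

variable [NeZero N]

theorem blockVectors_mem_waveSpace (hN : 3 ≤ N) (s : Shape) (θ₀ lam : ℝ) (p : Poles)
    (K : LBlock N) : ∀ (b : Fin 2) (a : Fin (hessSize p K)),
    blockVectors N s θ₀ lam p K b a ∈ waveSpace N p lam K.waveNumber :=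
  blockVectors_mem s θ₀ lam (fun p => waveSpace N p lam K.waveNumber) K
    (fun p => ringMode_mem_waveSpace hN symmetricFrame_theta s p lam θ₀ _)
    (fun p => ringMode_mem_waveSpace hN symmetricFrame_phi s p lam θ₀ _)
    (fun h => h ▸ poleMode_mem_waveSpace hN s lam) p

/-- The mode `N / 2` is left out because for `Nh` its list mixes both parities; it is already
isolated by its wave number. -/
theorem blockVectors_mem_exchangeSpace (hN : 3 ≤ N) (s : Shape) (θ₀ lam : ℝ) (p : Poles)
    (K : LBlock N) (hK : 2 * K.waveNumber < N) : ∀ (b : Fin 2) (a : Fin (hessSize p K)),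
    blockVectors N s θ₀ lam p K b a ∈ exchangeSpace N s p lam K.parity K.waveNumber := by
  have hθ := fun q ε (hε : ε * ε = 1) ψ => ringMode_mem_exchangeSpace hN symmetricFrame_theta
    (by norm_num) s p lam θ₀ q hε ψ
  have hφ := fun q ε (hε : ε * ε = 1) ψ => ringMode_mem_exchangeSpace hN symmetricFrame_phi
    (by norm_num) s p lam θ₀ q hε ψ
  have h1 : ∀ q, αθ N s p θ₀ q ∈ exchangeSpace N s p lam (-1) q := fun q => by
    rw [αθ_eq]; simpa using hθ q 1 (by norm_num) 0
  have h2 : ∀ q, αθ' N s p θ₀ q ∈ exchangeSpace N s p lam 1 q := fun q => by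
    rw [αθ'_eq]; simpa using hθ q (-1) (by norm_num) 0
  have h3 : ∀ q, αφ N s p θ₀ q ∈ exchangeSpace N s p lam 1 q := fun q => by
    rw [αφ_eq]; simpa using hφ q 1 (by norm_num) 0
  have h4 : ∀ q, αφ' N s p θ₀ q ∈ exchangeSpace N s p lam (-1) q := fun q => by
    rw [αφ'_eq]; simpa using hφ q (-1) (by norm_num) 0
  have h5 : ∀ q, βθ N s p θ₀ q ∈ exchangeSpace N s p lam (-1) q := fun q => by
    rw [βθ_eq]; simpa using hθ q 1 (by norm_num) (Real.pi / 2)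
  have h6 : ∀ q, βθ' N s p θ₀ q ∈ exchangeSpace N s p lam 1 q := fun q => by
    rw [βθ'_eq]; simpa using hθ q (-1) (by norm_num) (Real.pi / 2)
  have h7 : ∀ q, βφ N s p θ₀ q ∈ exchangeSpace N s p lam 1 q := fun q => by
    rw [βφ_eq]; simpa using hφ q 1 (by norm_num) (Real.pi / 2)
  have h8 : ∀ q, βφ' N s p θ₀ q ∈ exchangeSpace N s p lam (-1) q := fun q => by
    rw [βφ'_eq]; simpa using hφ q (-1) (by norm_num) (Real.pi / 2)
  have k1 : δxp N ∈ exchangeSpace N s .two lam 1 1 := by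
    rw [δxp_eq s]; exact poleMode_mem_exchangeSpace hN s lam (by norm_num) _
  have k2 : δyp N ∈ exchangeSpace N s .two lam 1 1 := by
    rw [δyp_eq s]; exact poleMode_mem_exchangeSpace hN s lam (by norm_num) _
  have k3 : δxp' N ∈ exchangeSpace N s .two lam (-1) 1 := by
    rw [δxp'_eq s]; exact poleMode_mem_exchangeSpace hN s lam (by norm_num) _
  have k4 : δyp' N ∈ exchangeSpace N s .two lam (-1) 1 := by
    rw [δyp'_eq s]; exact poleMode_mem_exchangeSpace hN s lam (by norm_num) _
  have sm := fun (c : ℝ) {d : ℝ} {q : ℕ} {u : Ambient N p}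
    (hu : u ∈ exchangeSpace N s p lam d q) => Submodule.smul_mem _ c hu
  cases K with
  | zero =>
    cases p <;> exact Fin.forall_fin_two.mpr
      ⟨Fin.forall_fin_one.mpr (h1 _), Fin.forall_fin_one.mpr (h4 _)⟩
  | one =>
    cases p
    · exact Fin.forall_fin_two.mpr
        ⟨Fin.forall_fin_two.mpr ⟨h7 _, h2 _⟩, Fin.forall_fin_two.mpr ⟨h3 _, h6 _⟩⟩
    · exact Fin.forall_fin_two.mpr
        ⟨forall_fin_three.mpr ⟨h7 _, h2 _, k1⟩, forall_fin_three.mpr ⟨h3 _, h6 _, k2⟩⟩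
  | bOne =>
    cases p
    · exact Fin.forall_fin_two.mpr
        ⟨Fin.forall_fin_one.mpr (add_mem (sm _ (h1 _)) (sm _ (h8 _))),
          Fin.forall_fin_one.mpr (sub_mem (sm _ (h5 _)) (sm _ (h4 _)))⟩
    · exact Fin.forall_fin_two.mpr
        ⟨Fin.forall_fin_two.mpr ⟨add_mem (sm _ (h1 _)) (sm _ (h8 _)), sub_mem (h1 _) (sm _ k3)⟩,
          Fin.forall_fin_two.mpr ⟨sub_mem (sm _ (h5 _)) (sm _ (h4 _)), sub_mem (h5 _) (sm _ k4)⟩⟩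
  | low q hq =>
    cases p <;> exact Fin.forall_fin_two.mpr
      ⟨Fin.forall_fin_two.mpr ⟨h1 _, h8 _⟩, Fin.forall_fin_two.mpr ⟨h5 _, h4 _⟩⟩
  | low' q hq =>
    cases p <;> exact Fin.forall_fin_two.mpr
      ⟨Fin.forall_fin_two.mpr ⟨h2 _, h7 _⟩, Fin.forall_fin_two.mpr ⟨h6 _, h3 _⟩⟩
  | half hN =>
    simp only [LBlock.waveNumber] at hK
    obtain ⟨k, rfl⟩ := hN
    omega

theorem blockVectors_mem_reflectionSpace (hN : 3 ≤ N) (s : Shape) (θ₀ lam : ℝ) (p : Poles)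
    (K : LBlock N) :
    (∀ a, blockVectors N s θ₀ lam p K 0 a ∈ reflectionSpace N s p lam 1) ∧
    (∀ a, blockVectors N s θ₀ lam p K 1 a ∈ reflectionSpace N s p lam (-1)) := by
  have hθ := ringMode_zero_mem_reflectionSpace hN symmetricFrame_theta s p lam θ₀
  have hφ := ringMode_zero_mem_reflectionSpace hN symmetricFrame_phi s p lam θ₀
  have hθ' := ringMode_pi_div_two_mem_reflectionSpace hN symmetricFrame_theta s p lam θ₀
  have hφ' := ringMode_pi_div_two_mem_reflectionSpace hN symmetricFrame_phi s p lam θ₀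
  have h1 : ∀ q, αθ N s p θ₀ q ∈ reflectionSpace N s p lam 1 := fun q => by
    rw [αθ_eq]; exact hθ _ _
  have h2 : ∀ q, αθ' N s p θ₀ q ∈ reflectionSpace N s p lam 1 := fun q => by
    rw [αθ'_eq]; exact hθ _ _
  have h3 : ∀ q, αφ N s p θ₀ q ∈ reflectionSpace N s p lam (-1) := fun q => by
    rw [αφ_eq]; exact hφ _ _
  have h4 : ∀ q, αφ' N s p θ₀ q ∈ reflectionSpace N s p lam (-1) := fun q => by
    rw [αφ'_eq]; exact hφ _ _
  have h5 : ∀ q, βθ N s p θ₀ q ∈ reflectionSpace N s p lam (-1) := fun q => by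
    rw [βθ_eq]; exact hθ' _ _
  have h6 : ∀ q, βθ' N s p θ₀ q ∈ reflectionSpace N s p lam (-1) := fun q => by
    rw [βθ'_eq]; exact hθ' _ _
  have h7 : ∀ q, βφ N s p θ₀ q ∈ reflectionSpace N s p lam 1 := fun q => by
    rw [βφ_eq]; simpa using hφ' q 1
  have h8 : ∀ q, βφ' N s p θ₀ q ∈ reflectionSpace N s p lam 1 := fun q => by
    rw [βφ'_eq]; simpa using hφ' q (-1)
  have k1 : δxp N ∈ reflectionSpace N s .two lam 1 := by
    rw [δxp_eq s]; exact poleMode_zero_mem_reflectionSpace hN s lam _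
  have k2 : δyp N ∈ reflectionSpace N s .two lam (-1) := by
    rw [δyp_eq s]; exact poleMode_pi_div_two_mem_reflectionSpace hN s lam _
  have k3 : δxp' N ∈ reflectionSpace N s .two lam 1 := by
    rw [δxp'_eq s]; exact poleMode_zero_mem_reflectionSpace hN s lam _
  have k4 : δyp' N ∈ reflectionSpace N s .two lam (-1) := by
    rw [δyp'_eq s]; exact poleMode_pi_div_two_mem_reflectionSpace hN s lam _
  have sm := fun (c : ℝ) {d : ℝ} {u : Ambient N p}
    (hu : u ∈ reflectionSpace N s p lam d) => Submodule.smul_mem _ c hu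
  cases K with
  | zero =>
    cases p <;> exact
      ⟨Fin.forall_fin_one.mpr (h1 _), Fin.forall_fin_one.mpr (h4 _)⟩
  | one =>
    cases p
    · exact ⟨Fin.forall_fin_two.mpr ⟨h7 _, h2 _⟩, Fin.forall_fin_two.mpr ⟨h3 _, h6 _⟩⟩
    · exact ⟨forall_fin_three.mpr ⟨h7 _, h2 _, k1⟩, forall_fin_three.mpr ⟨h3 _, h6 _, k2⟩⟩
  | bOne =>
    cases p
    · exact ⟨Fin.forall_fin_one.mpr (add_mem (sm _ (h1 _)) (sm _ (h8 _))),
        Fin.forall_fin_one.mpr (sub_mem (sm _ (h5 _)) (sm _ (h4 _)))⟩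
    · exact ⟨Fin.forall_fin_two.mpr ⟨add_mem (sm _ (h1 _)) (sm _ (h8 _)), sub_mem (h1 _) (sm _ k3)⟩,
        Fin.forall_fin_two.mpr ⟨sub_mem (sm _ (h5 _)) (sm _ (h4 _)), sub_mem (h5 _) (sm _ k4)⟩⟩
  | low q hq =>
    cases p <;> exact
      ⟨Fin.forall_fin_two.mpr ⟨h1 _, h8 _⟩, Fin.forall_fin_two.mpr ⟨h5 _, h4 _⟩⟩
  | low' q hq =>
    cases p <;> exact
      ⟨Fin.forall_fin_two.mpr ⟨h2 _, h7 _⟩, Fin.forall_fin_two.mpr ⟨h6 _, h3 _⟩⟩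
  | half hN =>
    cases s
    · cases p <;> exact
        ⟨Fin.forall_fin_two.mpr ⟨h2 _, h7 _⟩, Fin.forall_fin_two.mpr ⟨h6 _, h3 _⟩⟩
    · cases p <;> exact
        ⟨Fin.forall_fin_two.mpr ⟨h1 _, h2 _⟩, Fin.forall_fin_two.mpr ⟨h3 _, h4 _⟩⟩

end BlockTypes

/-! ### The Hessian and the symplectic form as bilinear maps -/

section Forms

variable {N : ℕ} {p : Poles}

/-- The Hessian as a bilinear form. -/
def hessianForm (f : Ambient N p → ℝ) (x : Ambient N p) :
    Ambient N p →ₗ[ℝ] Ambient N p →ₗ[ℝ] ℝ :=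
  -- Bilinearity holds for any `f`: the iterated `fderiv` is by type a linear map into linear maps,
  -- equal to zero where it does not exist.
  LinearMap.mk₂ ℝ (hessian f x) (by simp [hessian]) (by simp [hessian]) (by simp [hessian])
    (by simp [hessian])

/-- The symplectic form as a bilinear form. -/
def omegaForm (lam : ℝ) (x : Ambient N p) : Ambient N p →ₗ[ℝ] Ambient N p →ₗ[ℝ] ℝ :=
  LinearMap.mk₂ ℝ (symplecticForm lam x)
    (fun u u' v => by
      simp [symplecticForm, dotProduct_add, mul_add, Finset.sum_add_distrib])
    (fun c u v => by
      simp only [symplecticForm, Pi.smul_apply, map_smul, LinearMap.smul_apply, dotProduct_smul,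
        smul_eq_mul, Finset.mul_sum, mul_left_comm])
    (fun u v v' => by
      simp [symplecticForm, dotProduct_add, mul_add, Finset.sum_add_distrib])
    (fun c u v => by
      simp only [symplecticForm, Pi.smul_apply, map_smul, dotProduct_smul, smul_eq_mul,
        Finset.mul_sum, mul_left_comm])

theorem omegaForm_apply (lam : ℝ) (x u v : Ambient N p) :
    omegaForm lam x u v = symplecticForm lam x u v := rfl

end Forms

/-! ### Vanishing of the entries between different blocks -/

section Separation

variable {N : ℕ}

theorem LBlock.two_mul_waveNumber_le (hN : 3 ≤ N) (K : LBlock N) : 2 * K.waveNumber ≤ N := by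
  cases K <;> simp only [LBlock.waveNumber] <;> omega

/-- The only coincidences of wave number are `one` with `bOne` and `low q` with `low' q`, whose
parities are opposite; `half` shares its wave number with no other block. -/
theorem LBlock.parity_ne {K K' : LBlock N} (hK : K ≠ K') (h : K.waveNumber = K'.waveNumber)
    (hN : 3 ≤ N) : K.parity ≠ K'.parity ∧ 2 * K.waveNumber < N := by
  rcases K with _ | _ | _ | ⟨q, hq⟩ | ⟨q, hq⟩ | he <;>
    rcases K' with _ | _ | _ | ⟨q', hq'⟩ | ⟨q', hq'⟩ | he' <;>
    simp only [LBlock.waveNumber, LBlock.parity] at h ⊢ <;>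
    first
      | exact absurd rfl hK
      | omega
      | (rw [Nat.even_iff] at he; omega)
      | (rw [Nat.even_iff] at he'; omega)
      | (subst h; exact absurd rfl hK)
      | exact ⟨by norm_num, by omega⟩

/-- The angles `2πq/N` with `2q ≤ N` lie in `[0, π]`, where the cosine is injective. -/
theorem cos_wave_injective (hN : 3 ≤ N) {q q' : ℕ} (hq : 2 * q ≤ N) (hq' : 2 * q' ≤ N)
    (h : Real.cos (q * (2 * Real.pi / N)) = Real.cos (q' * (2 * Real.pi / N))) : q = q' := by
  have hN0 : (0 : ℝ) < N := by exact_mod_cast (by omega : 0 < N)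
  have key : ∀ q : ℕ, 2 * q ≤ N → (q : ℝ) * (2 * Real.pi / N) ∈ Set.Icc 0 Real.pi := by
    intro q hq
    have h1 : (2 : ℝ) * q ≤ N := by exact_mod_cast hq
    refine ⟨by positivity, ?_⟩
    rw [← mul_div_assoc, div_le_iff₀ hN0]
    nlinarith [Real.pi_pos]
  have h2 := Real.injOn_cos (key q hq) (key q' hq') h
  have h3 : (2 * Real.pi / N : ℝ) ≠ 0 := by positivity
  exact_mod_cast mul_right_cancel₀ h3 h2

theorem cos_two_pi_div_ne_one (hN : 3 ≤ N) : Real.cos (2 * Real.pi / N) ≠ 1 := by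
  intro h
  have := cos_wave_injective hN (q := 1) (q' := 0) (by omega) (by omega) (by simpa using h)
  omega

theorem sin_two_pi_div_ne_zero (hN : 3 ≤ N) : Real.sin (2 * Real.pi / N) ≠ 0 := by
  have hN3 : (3 : ℝ) ≤ N := by exact_mod_cast hN
  apply ne_of_gt
  apply Real.sin_pos_of_pos_of_lt_pi
  · positivity
  · rw [div_lt_iff₀ (by linarith)]
    nlinarith [Real.pi_pos]

theorem cos_offset_ne_zero (hN : 3 ≤ N) (s : Shape) {q : ℕ} (hq : 2 * q < N) :
    Real.cos (q * offset N s) ≠ 0 := by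
  have hN0 : (0 : ℝ) < N := by exact_mod_cast (by omega : 0 < N)
  have h1 : (2 : ℝ) * q < N := by exact_mod_cast hq
  apply ne_of_gt
  cases s
  · apply Real.cos_pos_of_mem_Ioo
    have h2 : (0 : ℝ) ≤ q * offset N .Nd := by
      unfold offset
      positivity
    refine ⟨by linarith [Real.pi_pos], ?_⟩
    unfold offset
    rw [← mul_div_assoc, div_lt_iff₀ hN0]
    nlinarith [Real.pi_pos]
  · simp [offset]

theorem omegaForm_act {p : Poles} {lam : ℝ} (g : VortexSymmetry N p lam) {x : Ambient N p}
    (hg : g.act x = x) (u v : Ambient N p) :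
    omegaForm lam x (g.act u) (g.act v) = g.kap * g.del * omegaForm lam x u v := by
  have := g.symplecticForm_act x u v
  rwa [hg] at this

variable [NeZero N]

/-- The rotation separates different wave numbers. For equal wave numbers the parities are opposite,
and the exchange eigenvalues `±2 cos(qφ₀)` differ because `cos(qφ₀) ≠ 0`. -/
theorem bilin_block_eq_zero (hN : 3 ≤ N) (s : Shape) (p : Poles) (θ₀ lam : ℝ)
    (B : Ambient N p →ₗ[ℝ] Ambient N p →ₗ[ℝ] ℝ)
    (hrot : ∀ u v, B ((rotation N p lam).act u) ((rotation N p lam).act v) = B u v)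
    (hexch : ∀ u v, B ((ringExchange N s p lam).act u) ((ringExchange N s p lam).act v) = B u v)
    {K K' : LBlock N} (hK : K ≠ K') (b b' : Fin 2) (a : Fin (hessSize p K))
    (a' : Fin (hessSize p K')) :
    B (blockVectors N s θ₀ lam p K b a) (blockVectors N s θ₀ lam p K' b' a') = 0 := by
  by_cases h : K.waveNumber = K'.waveNumber
  · obtain ⟨h1, h2⟩ := LBlock.parity_ne hK h hN
    refine bilin_eq_zero_of_symmSum B _ hexch ?_
      (blockVectors_mem_exchangeSpace hN s θ₀ lam p K h2 b a)
      (blockVectors_mem_exchangeSpace hN s θ₀ lam p K' (h ▸ h2) b' a')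
    rw [← h]
    intro h3
    exact h1 (mul_right_cancel₀ (mul_ne_zero two_ne_zero (cos_offset_ne_zero hN s h2)) h3)
  · refine bilin_eq_zero_of_symmSum B _ hrot ?_ (blockVectors_mem_waveSpace hN s θ₀ lam p K b a)
      (blockVectors_mem_waveSpace hN s θ₀ lam p K' b' a')
    intro h3
    exact h (cos_wave_injective hN (K.two_mul_waveNumber_le hN) (K'.two_mul_waveNumber_le hN)
      (mul_left_cancel₀ two_ne_zero h3))

theorem hessian_block_eq_zero (hN : 3 ≤ N) (s : Shape) (p : Poles) (θ₀ lam c : ℝ)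
    (i j : SliceIndex N p) (hij : hessBlock i ≠ hessBlock j) :
    hessianMatrix N s p θ₀ lam ![0, 0, c] i j = 0 := by
  obtain ⟨K, b, a⟩ := i
  obtain ⟨K', b', a'⟩ := j
  set B := hessianForm (augmentedHamiltonian lam (momentum lam (configuration N s p θ₀))
    ![0, 0, c]) (configuration N s p θ₀) with hB
  have key : ∀ g : VortexSymmetry N p lam,
      g.act (configuration N s p θ₀) = configuration N s p θ₀ →
      ∀ u v, B (g.act u) (g.act v) = B u v := by
    intro g hg u v
    have := g.hessian_act c (momentum lam (configuration N s p θ₀)) (configuration N s p θ₀) u v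
    rwa [hg] at this
  change B (blockVectors N s θ₀ lam p K b a) (blockVectors N s θ₀ lam p K' b' a') = 0
  by_cases hK : K = K'
  · subst hK
    have hb : b ≠ b' := fun h => hij (by rw [hessBlock, hessBlock, h])
    have hrefl := key _ (reflection_configuration hN s p lam θ₀)
    obtain ⟨h0, h1⟩ := blockVectors_mem_reflectionSpace hN s θ₀ lam p K
    -- The two halves have opposite parities under a symmetry preserving the Hessian, so each mixed
    -- entry equals its own opposite.
    simp only [mem_reflectionSpace] at h0 h1
    have h2 := hrefl (blockVectors N s θ₀ lam p K b a) (blockVectors N s θ₀ lam p K b' a')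
    obtain ⟨rfl, rfl⟩ | ⟨rfl, rfl⟩ : (b = 0 ∧ b' = 1) ∨ (b = 1 ∧ b' = 0) := by omega
    · rw [h0, h1, one_smul, map_smul, smul_eq_mul] at h2
      linarith
    · rw [h0, h1, one_smul, map_smul, LinearMap.smul_apply, smul_eq_mul] at h2
      linarith
  · exact bilin_block_eq_zero hN s p θ₀ lam B (key _ (rotation_configuration hN s p lam θ₀))
      (key _ (ringExchange_configuration hN s p lam θ₀)) hK b b' a a'

theorem omega_block_eq_zero (hN : 3 ≤ N) (s : Shape) (p : Poles) (θ₀ lam : ℝ)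
    {K K' : LBlock N} (hK : K ≠ K') (b b' : Fin 2) (a : Fin (hessSize p K))
    (a' : Fin (hessSize p K')) :
    omegaForm lam (configuration N s p θ₀) (blockVectors N s θ₀ lam p K b a)
      (blockVectors N s θ₀ lam p K' b' a') = 0 := by
  refine bilin_block_eq_zero hN s p θ₀ lam _ (fun u v => ?_) (fun u v => ?_) hK b b' a a'
  · rw [omegaForm_act _ (rotation_configuration hN s p lam θ₀)]
    simp [rotation]
  · rw [omegaForm_act _ (ringExchange_configuration hN s p lam θ₀)]
    simp [ringExchange]

/-- The reflection acts on both vectors by the same sign but reverses `ω`, so each half of a list is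
isotropic. -/
theorem omega_half_eq_zero (hN : 3 ≤ N) (s : Shape) (p : Poles) (θ₀ lam : ℝ)
    (K : LBlock N) (b : Fin 2) (a a' : Fin (hessSize p K)) :
    omegaForm lam (configuration N s p θ₀) (blockVectors N s θ₀ lam p K b a)
      (blockVectors N s θ₀ lam p K b a') = 0 := by
  obtain ⟨h0, h1⟩ := blockVectors_mem_reflectionSpace hN s θ₀ lam p K
  simp only [mem_reflectionSpace] at h0 h1
  have h2 := omegaForm_act _ (reflection_configuration hN s p lam θ₀)
    (blockVectors N s θ₀ lam p K b a) (blockVectors N s θ₀ lam p K b a')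
  have h3 : (reflection N s p lam).kap * (reflection N s p lam).del = -1 := by simp [reflection]
  rw [h3] at h2
  obtain rfl | rfl : b = 0 ∨ b = 1 := by omega
  · rw [h0, h0, one_smul, one_smul] at h2
    linarith
  · rw [h1, h1, map_smul, map_smul, LinearMap.smul_apply, smul_eq_mul, smul_eq_mul] at h2
    linarith

end Separation

/-! ### Existence and uniqueness of the angular velocity -/

section Equilibrium

variable {N : ℕ} [NeZero N]

theorem forall_fin_of_succ {P : Fin N → Prop} (h0 : P 0) (h : ∀ j, P j → P (j + 1)) (j : Fin N) :
    P j := by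
  have key : ∀ (n : ℕ) (hn : n < N), P ⟨n, hn⟩ := by
    intro n
    induction n with
    | zero => intro _; exact h0
    | succ n ih =>
      intro hn
      have h2 : (⟨n + 1, hn⟩ : Fin N) = ⟨n, by omega⟩ + 1 := by
        ext
        have h1 : ((1 : Fin N) : ℕ) = 1 := by
          rw [Fin.val_one']
          exact Nat.mod_eq_of_lt (by omega)
        rw [Fin.val_add, h1]
        exact (Nat.mod_eq_of_lt hn).symm
      rw [h2]
      exact h _ (ih _)
  exact key j.1 j.2

theorem horizontal_eq_zero_of_rotation_fixed (hN : 3 ≤ N) {p : Poles} {lam : ℝ} {v : Fin 3 → ℝ}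
    (hv : (rotation N p lam).iso v = v) : v 0 = 0 ∧ v 1 = 0 := by
  have h0 := congrFun hv 0
  have h1 := congrFun hv 1
  simp only [rotation, axisIso_apply, cons_val, one_mul] at h0 h1
  have hc := cos_two_pi_div_ne_one hN
  have hcs := Real.cos_sq_add_sin_sq (2 * Real.pi / N)
  set c := Real.cos (2 * Real.pi / N)
  set s := Real.sin (2 * Real.pi / N)
  have hne : 2 * (1 - c) ≠ 0 := mul_ne_zero two_ne_zero (sub_ne_zero.mpr (Ne.symm hc))
  constructor
  -- The factor `2 * (1 - c)` is the determinant of the plane rotation minus the identity; the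
  -- combination is Cramer's rule.
  · refine (mul_eq_zero.mp (?_ : 2 * (1 - c) * v 0 = 0)).resolve_left hne
    linear_combination -(1 - c) * h0 + s * h1 - v 0 * hcs
  · refine (mul_eq_zero.mp (?_ : 2 * (1 - c) * v 1 = 0)).resolve_left hne
    linear_combination -(1 - c) * h1 - s * h0 - v 1 * hcs

theorem configuration_plus_zero (s : Shape) (p : Poles) (θ₀ : ℝ) :
    configuration N s p θ₀ (.inl 0) = ![Real.sin θ₀, 0, Real.cos θ₀] := by
  simp [configuration, spherical, longitude]

theorem exists_angularVelocity (hN : 3 ≤ N) (s : Shape) (p : Poles) (lam : ℝ) {θ₀ : ℝ}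
    (hs : Real.sin θ₀ ≠ 0) :
    ∃ c, IsRelativeEquilibrium lam (configuration N s p θ₀) ![0, 0, c] := by
  set x := configuration N s p θ₀ with hx
  -- At the first vortex `(sin θ₀, 0, cos θ₀)` the generator of `(0, 0, c)` is `(0, c sin θ₀, 0)`,
  -- so `c` is forced by the second component.
  set c := vectorField lam x (.inl 0) 1 / Real.sin θ₀ with hc
  refine ⟨c, ?_⟩
  have transport : ∀ g : VortexSymmetry N p lam, g.act x = x → ∀ i,
      vectorField lam x (g.perm i) = (g.kap * g.del) • g.iso (vectorField lam x i) := by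
    intro g hg i
    have := g.vectorField_act x i
    rwa [hg] at this
  have transport' : ∀ g : VortexSymmetry N p lam, g.act x = x → ∀ i,
      vectorField lam x i = generator ![0, 0, c] x i →
      vectorField lam x (g.perm i) = generator ![0, 0, c] x (g.perm i) := by
    intro g hg i hi
    have := g.generator_act c x i
    rw [hg] at this
    rw [this, transport g hg, hi]
  have h0 : vectorField lam x (.inl 0) = generator ![0, 0, c] x (.inl 0) := by
    -- The reflection fixes this vortex and reverses the field up to its own action, so only the
    -- component normal to the mirror plane survives.
    have h1 := transport _ (reflection_configuration hN s p lam θ₀) (.inl 0)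
    rw [reflection_perm_plus, neg_zero] at h1
    have h10 := congrFun h1 0
    have h12 := congrFun h1 2
    simp [reflection, axisIso_apply] at h10 h12
    rw [generator, hx, configuration_plus_zero, ← hx, cross_apply]
    ext m
    fin_cases m
    · simp
      linarith
    · simp [hc, hs]
    · simp
      linarith
  have hplus : ∀ j, vectorField lam x (.inl j) = generator ![0, 0, c] x (.inl j) :=
    forall_fin_of_succ h0 fun j hj =>
      transport' _ (rotation_configuration hN s p lam θ₀) (.inl j) hj
  unfold IsRelativeEquilibrium
  funext i
  rcases i with j | j | k
  · exact hplus j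
  · exact transport' _ (ringExchange_configuration hN s p lam θ₀) (.inl j) (hplus j)
  -- At a pole the field is fixed by the rotation, hence vertical, and tangent to the sphere, hence
  -- horizontal: it vanishes, as does the generator.
  · have h1 := transport _ (rotation_configuration hN s p lam θ₀) (.inr (.inr k))
    have h2 : (rotation N p lam).kap * (rotation N p lam).del = 1 := by simp [rotation]
    rw [rotation_perm_pole, h2, one_smul] at h1
    obtain ⟨h3, h4⟩ := horizontal_eq_zero_of_rotation_fixed hN h1.symm
    have hk : x (.inr (.inr k)) 0 = 0 ∧ x (.inr (.inr k)) 1 = 0 := by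
      simp only [hx, configuration]
      split_ifs <;> simp
    have h5 : vectorField lam x (.inr (.inr k)) 2 = 0 := by
      rw [vectorField, Finset.sum_apply]
      refine Finset.sum_eq_zero fun j _ => ?_
      split_ifs
      · rfl
      · simp [cross_apply, hk.1, hk.2]
    have h6 : generator ![0, 0, c] x (.inr (.inr k)) = 0 := by
      rw [generator, cross_apply]
      simp [hk.1, hk.2]
    rw [h6]
    ext m
    fin_cases m
    · exact h3
    · exact h4
    · exact h5

/-- Only two vortices of the (+)ring are used, at longitudes `0` and `2π/N`: they are linearly
independent since `sin(2π/N) ≠ 0`, so no nonzero vector has zero cross product with both. -/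
theorem angularVelocity_unique (hN : 3 ≤ N) (s : Shape) (p : Poles) (lam : ℝ) {θ₀ : ℝ}
    (hs : Real.sin θ₀ ≠ 0) {ξ ξ' : Fin 3 → ℝ}
    (h : IsRelativeEquilibrium lam (configuration N s p θ₀) ξ)
    (h' : IsRelativeEquilibrium lam (configuration N s p θ₀) ξ') : ξ' = ξ := by
  have h1 : generator ξ (configuration N s p θ₀) = generator ξ' (configuration N s p θ₀) :=
    h.symm.trans h'
  have hx1 : configuration N s p θ₀ (.inl 1) = spherical θ₀ (2 * Real.pi / N) := by
    rw [configuration, longitude_one hN]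
  have e0 := congrFun h1 (.inl 0)
  have e1 := congrFun h1 (.inl 1)
  simp only [generator, configuration_plus_zero, hx1, spherical, cross_apply] at e0 e1
  have e02 := congrFun e0 2
  have e10 := congrFun e1 0
  have e12 := congrFun e1 2
  simp at e02 e10 e12
  have ha := sin_two_pi_div_ne_zero hN
  have d1 : ξ' 1 = ξ 1 := by
    rcases e02 with h | h
    · exact h.symm
    · exact absurd h hs
  rw [d1] at e10 e12
  have d0 : ξ' 0 = ξ 0 := by
    have := mul_ne_zero hs ha
    apply mul_right_cancel₀ this
    linear_combination -e12
  have d2 : ξ' 2 = ξ 2 := by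
    have := mul_ne_zero hs ha
    apply mul_right_cancel₀ this
    linear_combination e10
  ext m
  fin_cases m
  · exact d0
  · exact d1
  · exact d2

end Equilibrium

/-! ### Trigonometric sums over a ring -/

section Sums

variable {N : ℕ}

theorem sum_cos_of_dvd (ψ : ℝ) (m : ℕ) (hm : N ∣ m) :
    ∑ j : Fin N, Real.cos (m * longitude j - ψ) = N * Real.cos ψ := by
  obtain ⟨k, rfl⟩ := hm
  have h : ∀ j : Fin N, Real.cos ((N * k : ℕ) * longitude j - ψ) = Real.cos ψ := by
    intro j
    have hN : (N : ℝ) ≠ 0 := by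
      have := j.pos
      exact_mod_cast this.ne'
    have h1 : ((N * k : ℕ) : ℝ) * longitude j - ψ = (k * j.val : ℕ) * (2 * Real.pi) - ψ := by
      unfold longitude
      push_cast
      field_simp
    rw [h1, Real.cos_nat_mul_two_pi_sub]
  simp only [h, Finset.sum_const, Finset.card_univ, Fintype.card_fin, nsmul_eq_mul]

theorem sum_cos_mul_cos_eq (ψ ψ' : ℝ) (q : ℕ) :
    ∑ j : Fin N, Real.cos (q * longitude j - ψ) * Real.cos (q * longitude j - ψ')
      = N / 2 * Real.cos (ψ - ψ')
        + (∑ j : Fin N, Real.cos ((2 * q : ℕ) * longitude j - (ψ + ψ'))) / 2 := by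
  have h : ∀ j : Fin N, Real.cos (q * longitude j - ψ) * Real.cos (q * longitude j - ψ')
      = Real.cos (ψ - ψ') / 2 + Real.cos ((2 * q : ℕ) * longitude j - (ψ + ψ')) / 2 := by
    intro j
    have e1 : ψ - ψ' = (q * longitude j - ψ') - (q * longitude j - ψ) := by ring
    have e2 : ((2 * q : ℕ) : ℝ) * longitude j - (ψ + ψ')
        = (q * longitude j - ψ') + (q * longitude j - ψ) := by push_cast; ring
    rw [e1, e2, Real.cos_sub (q * longitude j - ψ'), Real.cos_add (q * longitude j - ψ')]
    ring
  simp only [h, Finset.sum_add_distrib, Finset.sum_div, Finset.sum_const, Finset.card_univ,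
    Fintype.card_fin, nsmul_eq_mul]
  ring

theorem sum_cos_mul_cos_of_dvd (ψ ψ' : ℝ) {q : ℕ} (hq : N ∣ 2 * q) :
    ∑ j : Fin N, Real.cos (q * longitude j - ψ) * Real.cos (q * longitude j - ψ')
      = N * (Real.cos ψ * Real.cos ψ') := by
  rw [sum_cos_mul_cos_eq, sum_cos_of_dvd _ _ hq, Real.cos_add, Real.cos_sub]
  ring

variable [NeZero N]

/-- Shifting the index shows that the sum is unchanged when its phase moves by `x = 2πm/N`.
Averaging the shifts by `x` and `-x` multiplies it by `cos x ≠ 1`, so it is zero. -/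
theorem sum_cos_eq_zero (hN : 3 ≤ N) (ψ : ℝ) {m : ℕ} (hm : 0 < m) (hmN : m < N) :
    ∑ j : Fin N, Real.cos (m * longitude j - ψ) = 0 := by
  set S : ℝ → ℝ := fun ψ => ∑ j : Fin N, Real.cos (m * longitude j - ψ) with hS
  set x : ℝ := m * (2 * Real.pi / N) with hx
  have h1 : ∀ ψ, S (ψ - x) = S ψ := by
    intro ψ
    simp only [hS]
    rw [← Equiv.sum_comp (Equiv.addRight (1 : Fin N)) (fun j => Real.cos (m * longitude j - ψ))]
    refine Finset.sum_congr rfl fun j _ => ?_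
    have hp : Function.Periodic (fun t : ℝ => Real.cos (m * t - ψ)) (2 * Real.pi) := fun t => by
      have h : (m : ℝ) * (t + 2 * Real.pi) - ψ = (m * t - ψ) + m * (2 * Real.pi) := by ring
      simp only [h, Real.cos_add_nat_mul_two_pi]
    have h2 := periodic_longitude_add hp j 1
    simp only [longitude_one hN] at h2
    rw [Equiv.coe_addRight, h2, hx]
    congr 1
    ring
  have h2 : S (ψ + x) = S ψ := by rw [← h1 (ψ + x), add_sub_cancel_right]
  have h3 : S (ψ + x) + S (ψ - x) = 2 * Real.cos x * S ψ := by
    simp only [hS, ← Finset.sum_add_distrib, Finset.mul_sum]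
    refine Finset.sum_congr rfl fun j _ => ?_
    rw [← sub_sub, ← sub_add, Real.cos_sub (m * longitude j - ψ),
      Real.cos_add (m * longitude j - ψ)]
    ring
  have h4 : Real.cos x ≠ 1 := by
    have hN0 : (0 : ℝ) < N := by exact_mod_cast (by omega : 0 < N)
    have hm0 : (0 : ℝ) < m := by exact_mod_cast hm
    have hm1 : (m : ℝ) < N := by exact_mod_cast hmN
    have hx0 : 0 < x := by positivity
    have hx1 : x < 2 * Real.pi := by
      rw [hx, ← mul_div_assoc, div_lt_iff₀ hN0]
      nlinarith [Real.pi_pos]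
    intro h
    exact hx0.ne' ((Real.cos_eq_one_iff_of_lt_of_lt (by linarith [Real.pi_pos]) hx1).mp h)
  rw [h1, h2] at h3
  have h5 : (1 - Real.cos x) * S ψ = 0 := by linear_combination h3 / 2
  exact (mul_eq_zero.mp h5).resolve_left (sub_ne_zero.mpr (Ne.symm h4))

theorem sum_cos_mul_cos (hN : 3 ≤ N) (ψ ψ' : ℝ) {q : ℕ} (hq : 0 < q) (hqN : 2 * q < N) :
    ∑ j : Fin N, Real.cos (q * longitude j - ψ) * Real.cos (q * longitude j - ψ')
      = N / 2 * Real.cos (ψ - ψ') := by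
  rw [sum_cos_mul_cos_eq, sum_cos_eq_zero hN _ (by omega) hqN]
  ring

end Sums

/-! ### Values of the symplectic form and of the momentum on modes -/

section Values

variable {N : ℕ}

theorem sum_vortex {p : Poles} (f : Vortex N p → ℝ) :
    ∑ i, f i = ∑ j, f (.inl j) + (∑ j, f (.inr (.inl j)) + ∑ k, f (.inr (.inr k))) := by
  rw [Fintype.sum_sum_type, Fintype.sum_sum_type]

/-- The sum `∑_j cos(qφ_j - ψ) cos(qφ_j - ψ')` over one ring. -/
def ringSum (N q : ℕ) (ψ ψ' : ℝ) : ℝ :=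
  ∑ j : Fin N, Real.cos (q * longitude j - ψ) * Real.cos (q * longitude j - ψ')

/-- The offset of the (-)ring is absorbed into the phases; when `0 < q` and `2q < N` only their
difference matters and the offset disappears. -/
theorem ringSum_offset (s : Shape) (q : ℕ) (ψ ψ' : ℝ) :
    ∑ j : Fin N, Real.cos (q * (longitude j + offset N s) - ψ)
      * Real.cos (q * (longitude j + offset N s) - ψ')
      = ringSum N q (ψ - q * offset N s) (ψ' - q * offset N s) := by
  refine Finset.sum_congr rfl fun j _ => ?_
  congr 2 <;> ring

theorem spherical_dot_theta_cross_phi (θ t : ℝ) :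
    spherical θ t ⬝ᵥ (dSphericalTheta θ t ⨯₃ dSphericalPhi θ t) = Real.sin θ := by
  simp [spherical, dSphericalTheta, dSphericalPhi, cross_apply, dotProduct, Fin.sum_univ_three]
  have h1 := Real.cos_sq_add_sin_sq θ
  have h2 := Real.cos_sq_add_sin_sq t
  linear_combination (Real.sin θ ^ 3 + Real.sin θ * Real.cos θ ^ 2) * h2 + Real.sin θ * h1

theorem omegaForm_ringMode_theta_phi (s : Shape) (p : Poles) (lam θ₀ : ℝ) (q : ℕ)
    (ε ε' ψ ψ' : ℝ) :
    omegaForm lam (configuration N s p θ₀) (ringMode N s p θ₀ dSphericalTheta q ε ψ)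
      (ringMode N s p θ₀ dSphericalPhi q ε' ψ')
    = Real.sin θ₀ * (ringSum N q ψ ψ'
        - ε * ε' * ringSum N q (ψ - q * offset N s) (ψ' - q * offset N s)) := by
  rw [omegaForm_apply, symplecticForm, sum_vortex, ← ringSum_offset, ringSum, mul_sub,
    Finset.mul_sum, Finset.mul_sum, Finset.mul_sum, sub_eq_add_neg, ← Finset.sum_neg_distrib]
  congr 1
  · refine Finset.sum_congr rfl fun j _ => ?_
    simp only [ringMode, ringField_plus, configuration_eq, vorticity, map_smul,
      LinearMap.smul_apply, dotProduct_smul, spherical_dot_theta_cross_phi, smul_eq_mul]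
    ring
  · rw [Finset.sum_eq_zero (s := (Finset.univ : Finset (Fin p.count))), add_zero]
    · refine Finset.sum_congr rfl fun j _ => ?_
      simp only [ringMode, ringField_minus, configuration_eq, vorticity, map_smul,
        LinearMap.smul_apply, dotProduct_smul, spherical_dot_theta_cross_phi, smul_eq_mul,
        Real.sin_pi_sub]
      ring
    · intro k _
      simp [ringMode, ringField_pole]

theorem omegaForm_self_frame (s : Shape) (p : Poles) (lam θ₀ : ℝ) (w : ℝ → ℝ → Fin 3 → ℝ) (q : ℕ)
    (ε ε' ψ ψ' : ℝ) :
    omegaForm lam (configuration N s p θ₀) (ringMode N s p θ₀ w q ε ψ)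
      (ringMode N s p θ₀ w q ε' ψ') = 0 := by
  rw [omegaForm_apply, symplecticForm]
  refine Finset.sum_eq_zero fun i _ => ?_
  rcases i with j | j | k
  · simp [ringMode, ringField_plus]
  · simp [ringMode, ringField_minus]
  · simp [ringMode, ringField_pole]

theorem omegaForm_skew {p : Poles} (lam : ℝ) (x u v : Ambient N p) :
    omegaForm lam x u v = -omegaForm lam x v u := by
  rw [omegaForm_apply, omegaForm_apply, symplecticForm, symplecticForm, ← Finset.sum_neg_distrib]
  refine Finset.sum_congr rfl fun i _ => ?_
  rw [← cross_anticomm, dotProduct_neg, mul_neg]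

theorem omegaForm_ringMode_poleMode (s : Shape) (lam θ₀ : ℝ) (w : ℝ → ℝ → Fin 3 → ℝ) (q : ℕ)
    (ε ε' ψ ψ' : ℝ) :
    omegaForm lam (configuration N s .two θ₀) (ringMode N s .two θ₀ w q ε ψ)
      (poleMode N s ε' ψ') = 0 := by
  rw [omegaForm_apply, symplecticForm]
  refine Finset.sum_eq_zero fun i _ => ?_
  rcases i with j | j | k
  · simp [poleMode, ringField]
  · simp [poleMode, ringField]
  · simp [ringMode, ringField]

theorem omegaForm_poleMode_ringMode (s : Shape) (lam θ₀ : ℝ) (w : ℝ → ℝ → Fin 3 → ℝ) (q : ℕ)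
    (ε ε' ψ ψ' : ℝ) :
    omegaForm lam (configuration N s .two θ₀) (poleMode N s ε' ψ')
      (ringMode N s .two θ₀ w q ε ψ) = 0 := by
  rw [omegaForm_skew, omegaForm_ringMode_poleMode, neg_zero]

theorem omegaForm_poleMode (s : Shape) (lam θ₀ : ℝ) (ε ε' ψ ψ' : ℝ) :
    omegaForm lam (configuration N s .two θ₀) (poleMode N s ε ψ) (poleMode N s ε' ψ')
      = lam * (1 + ε * ε') * Real.sin (ψ' - ψ) := by
  rw [omegaForm_apply, symplecticForm, sum_vortex, Finset.sum_eq_zero, Finset.sum_eq_zero,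
    Fin.sum_univ_two, Real.sin_sub]
  · simp [poleMode, ringField, poleField, configuration, vorticity, cross_apply, dotProduct,
      Fin.sum_univ_three]
    ring
  · intro j _
    simp [poleMode, ringField]
  · intro j _
    simp [poleMode, ringField]

/-- The centre of vorticity as a linear map. -/
def momentumMap (N : ℕ) (p : Poles) (lam : ℝ) : Ambient N p →ₗ[ℝ] (Fin 3 → ℝ) where
  toFun := momentum lam
  map_add' u v := by simp only [momentum, Pi.add_apply, smul_add, Finset.sum_add_distrib]
  map_smul' c v := by
    simp only [momentum, Pi.smul_apply, Finset.smul_sum, RingHom.id_apply]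
    exact Finset.sum_congr rfl fun i _ => smul_comm _ _ _

theorem momentumMap_apply {p : Poles} (lam : ℝ) (v : Ambient N p) :
    momentumMap N p lam v = momentum lam v := rfl

theorem momentum_apply {p : Poles} (lam : ℝ) (v : Ambient N p) (m : Fin 3) :
    momentum lam v m = ∑ i, vorticity lam i * v i m := by
  simp only [momentum, Finset.sum_apply, Pi.smul_apply, smul_eq_mul]

/-- Horizontal components of the frame are first harmonics in the longitude, so the momentum is
again a sum of products of cosines. -/
theorem momentum_ringMode (s : Shape) (p : Poles) (lam θ₀ : ℝ) (w : ℝ → ℝ → Fin 3 → ℝ)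
    (ε ψ : ℝ) (m : Fin 3) {f : ℝ → ℝ} {ψ' : ℝ}
    (hf : ∀ θ t, w θ t m = f θ * Real.cos ((1 : ℕ) * t - ψ')) :
    momentum lam (ringMode N s p θ₀ w 1 ε ψ) m
      = f θ₀ * ringSum N 1 ψ ψ'
        - f (Real.pi - θ₀) * ε * ringSum N 1 (ψ - (1 : ℕ) * offset N s)
            (ψ' - (1 : ℕ) * offset N s) := by
  rw [momentum_apply, sum_vortex, ← ringSum_offset, ringSum, Finset.mul_sum, Finset.mul_sum,
    sub_eq_add_neg, ← Finset.sum_neg_distrib]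
  congr 1
  · refine Finset.sum_congr rfl fun j _ => ?_
    simp only [ringMode, ringField_plus, vorticity, Pi.smul_apply, hf, smul_eq_mul]
    ring
  · rw [Finset.sum_eq_zero (s := (Finset.univ : Finset (Fin p.count))), add_zero]
    · refine Finset.sum_congr rfl fun j _ => ?_
      simp only [ringMode, ringField_minus, vorticity, Pi.smul_apply, hf, smul_eq_mul]
      ring
    · intro k _
      simp [ringMode, ringField_pole]

theorem momentum_poleMode (s : Shape) (lam : ℝ) (ε ψ : ℝ) :
    momentum lam (poleMode N s ε ψ) = (lam * (1 - ε)) • ![Real.cos ψ, Real.sin ψ, 0] := by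
  ext m
  rw [momentum_apply, sum_vortex, Finset.sum_eq_zero, Finset.sum_eq_zero, Fin.sum_univ_two]
  · fin_cases m <;> simp [poleMode, ringField, poleField, vorticity] <;> ring
  · intro j _
    simp [poleMode, ringField]
  · intro j _
    simp [poleMode, ringField]

variable [NeZero N]

theorem ringSum_eq (hN : 3 ≤ N) (ψ ψ' : ℝ) {q : ℕ} (hq : 0 < q) (hqN : 2 * q < N) :
    ringSum N q ψ ψ' = N / 2 * Real.cos (ψ - ψ') := sum_cos_mul_cos hN ψ ψ' hq hqN

theorem momentum_ringMode_theta (hN : 3 ≤ N) (s : Shape) (p : Poles) (lam θ₀ ε ψ : ℝ) :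
    momentum lam (ringMode N s p θ₀ dSphericalTheta 1 ε ψ) 0
        = N / 2 * (1 + ε) * Real.cos θ₀ * Real.cos ψ ∧
    momentum lam (ringMode N s p θ₀ dSphericalTheta 1 ε ψ) 1
        = N / 2 * (1 + ε) * Real.cos θ₀ * Real.sin ψ := by
  constructor
  · rw [momentum_ringMode s p lam θ₀ dSphericalTheta ε ψ 0 (f := Real.cos) (ψ' := 0)
      (fun θ t => by simp [dSphericalTheta]), ringSum_eq hN _ _ one_pos (by omega),
      ringSum_eq hN _ _ one_pos (by omega), sub_sub_sub_cancel_right, Real.cos_pi_sub, sub_zero]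
    ring
  · rw [momentum_ringMode s p lam θ₀ dSphericalTheta ε ψ 1 (f := Real.cos) (ψ' := Real.pi / 2)
      (fun θ t => by simp [dSphericalTheta, Real.cos_sub_pi_div_two]),
      ringSum_eq hN _ _ one_pos (by omega),
      ringSum_eq hN _ _ one_pos (by omega), sub_sub_sub_cancel_right, Real.cos_pi_sub,
      Real.cos_sub_pi_div_two]
    ring

theorem momentum_ringMode_phi (hN : 3 ≤ N) (s : Shape) (p : Poles) (lam θ₀ ε ψ : ℝ) :
    momentum lam (ringMode N s p θ₀ dSphericalPhi 1 ε ψ) 0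
        = -(N / 2 * (1 - ε) * Real.sin θ₀ * Real.sin ψ) ∧
    momentum lam (ringMode N s p θ₀ dSphericalPhi 1 ε ψ) 1
        = N / 2 * (1 - ε) * Real.sin θ₀ * Real.cos ψ := by
  constructor
  · rw [momentum_ringMode s p lam θ₀ dSphericalPhi ε ψ 0 (f := fun θ => -Real.sin θ)
      (ψ' := Real.pi / 2)
      (fun θ t => by simp [dSphericalPhi, Real.cos_sub_pi_div_two]),
      ringSum_eq hN _ _ one_pos (by omega),
      ringSum_eq hN _ _ one_pos (by omega), sub_sub_sub_cancel_right, Real.sin_pi_sub,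
      Real.cos_sub_pi_div_two]
    ring
  · rw [momentum_ringMode s p lam θ₀ dSphericalPhi ε ψ 1 (f := Real.sin) (ψ' := 0)
      (fun θ t => by simp [dSphericalPhi]), ringSum_eq hN _ _ one_pos (by omega),
      ringSum_eq hN _ _ one_pos (by omega), sub_sub_sub_cancel_right, Real.sin_pi_sub, sub_zero]
    ring

/-- The factor `N cos θ₀ + λ k_p / 2` of the centre of vorticity of the configuration. -/
def momentumFactor (N : ℕ) (lam θ₀ : ℝ) : Poles → ℝ
  | .absent => N * Real.cos θ₀
  | .two => N * Real.cos θ₀ + lam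

theorem momentum_configuration (hN : 3 ≤ N) (s : Shape) (p : Poles) (lam θ₀ : ℝ) :
    momentum lam (configuration N s p θ₀) = ![0, 0, 2 * momentumFactor N lam θ₀ p] := by
  have h1 := (rotation N p lam).momentum_act (configuration N s p θ₀)
  have h2 : (rotation N p lam).kap = 1 := rfl
  rw [rotation_configuration hN, h2, one_smul] at h1
  obtain ⟨h3, h4⟩ := horizontal_eq_zero_of_rotation_fixed hN h1.symm
  ext m
  fin_cases m
  · exact h3
  · exact h4
  · change momentum lam (configuration N s p θ₀) 2 = 2 * momentumFactor N lam θ₀ p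
    rw [momentum_apply, sum_vortex]
    cases p
    · simp [configuration, vorticity, spherical, momentumFactor]
      ring
    · simp [configuration, vorticity, spherical, momentumFactor, Fin.sum_univ_two]
      ring

end Values

/-! ### Membership of the vectors in the symplectic slice -/

section SliceMembership

variable {N : ℕ}

/-- The tangent space of the product of spheres. -/
def tangentSubmodule {p : Poles} (x : Ambient N p) : Submodule ℝ (Ambient N p) where
  carrier := {v | ∀ i, v i ⬝ᵥ x i = 0}
  zero_mem' := by simp
  add_mem' := by
    intro a b ha hb i
    rw [Pi.add_apply, add_dotProduct, ha i, hb i, add_zero]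
  smul_mem' := by
    intro c a ha i
    rw [Pi.smul_apply, smul_dotProduct, ha i, smul_zero]

theorem theta_dot_spherical (θ t : ℝ) : dSphericalTheta θ t ⬝ᵥ spherical θ t = 0 := by
  simp [spherical, dSphericalTheta, dotProduct, Fin.sum_univ_three]
  linear_combination (Real.sin θ * Real.cos θ) * Real.cos_sq_add_sin_sq t

theorem phi_dot_spherical (θ t : ℝ) : dSphericalPhi θ t ⬝ᵥ spherical θ t = 0 := by
  simp [spherical, dSphericalPhi, dotProduct, Fin.sum_univ_three]
  ring

theorem ringMode_mem_tangentSubmodule (s : Shape) (p : Poles) (θ₀ : ℝ) {w : ℝ → ℝ → Fin 3 → ℝ}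
    (hw : ∀ θ t, w θ t ⬝ᵥ spherical θ t = 0) (q : ℕ) (ε ψ : ℝ) :
    ringMode N s p θ₀ w q ε ψ ∈ tangentSubmodule (configuration N s p θ₀) := by
  rintro (j | j | k)
  · simp [ringMode, ringField, configuration, hw]
  · simp [ringMode, ringField, configuration, hw]
  · simp [ringMode, ringField]

theorem poleMode_mem_tangentSubmodule (s : Shape) (θ₀ ε ψ : ℝ) :
    poleMode N s ε ψ ∈ tangentSubmodule (configuration N s .two θ₀) := by
  rintro (j | j | k)
  · simp [poleMode, ringField]
  · simp [poleMode, ringField]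
  · fin_cases k <;> simp [poleMode, ringField, poleField, configuration]

/-- The pairing with the infinitesimal rotation around the vertical axis. -/
def verticalPairing {p : Poles} (x : Ambient N p) : Ambient N p →ₗ[ℝ] ℝ where
  toFun v := ∑ i, v i ⬝ᵥ generator ![0, 0, 1] x i
  map_add' u v := by simp only [Pi.add_apply, add_dotProduct, Finset.sum_add_distrib]
  map_smul' c v := by
    simp only [Pi.smul_apply, smul_dotProduct, Finset.smul_sum, RingHom.id_apply]

theorem verticalPairing_act {p : Poles} {lam : ℝ} (g : VortexSymmetry N p lam) {x : Ambient N p}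
    (hg : g.act x = x) (v : Ambient N p) :
    verticalPairing x (g.act v) = g.kap * g.del * verticalPairing x v := by
  change ∑ i, g.act v i ⬝ᵥ generator ![0, 0, 1] x i
    = g.kap * g.del * ∑ i, v i ⬝ᵥ generator ![0, 0, 1] x i
  rw [← Equiv.sum_comp g.perm, Finset.mul_sum]
  refine Finset.sum_congr rfl fun i _ => ?_
  have := g.generator_act 1 x i
  rw [hg] at this
  rw [this, g.act_apply_perm, dotProduct_smul, g.dot_iso, smul_eq_mul]

/-- The vertical component of the centre of vorticity. -/
def verticalMomentum (N : ℕ) (p : Poles) (lam : ℝ) : Ambient N p →ₗ[ℝ] ℝ :=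
  (LinearMap.proj 2).comp (momentumMap N p lam)

theorem verticalMomentum_act {p : Poles} {lam : ℝ} (g : VortexSymmetry N p lam)
    (v : Ambient N p) : verticalMomentum N p lam (g.act v) = verticalMomentum N p lam v := by
  change momentum lam (g.act v) 2 = momentum lam v 2
  rw [g.momentum_act, Pi.smul_apply, g.vertical_iso, smul_eq_mul, ← mul_assoc, g.kap_sq, one_mul]

variable [NeZero N]

/-- Nonzero wave numbers are excluded by the rotation. The only block of wave number `0` has parity
`-1`, hence exchange eigenvalue `-2` rather than `2`. -/
theorem functional_block_eq_zero (hN : 3 ≤ N) (s : Shape) (p : Poles) (θ₀ lam : ℝ)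
    (F : Ambient N p →ₗ[ℝ] ℝ) (hrot : ∀ u, F ((rotation N p lam).act u) = F u)
    (hexch : ∀ u, F ((ringExchange N s p lam).act u) = F u)
    (K : LBlock N) (b : Fin 2) (a : Fin (hessSize p K)) :
    F (blockVectors N s θ₀ lam p K b a) = 0 := by
  by_cases h : K.waveNumber = 0
  · have h1 := blockVectors_mem_exchangeSpace hN s θ₀ lam p K (by omega) b a
    refine functional_eq_zero_of_symmSum F _ hexch ?_ h1
    have h2 : K.parity = -1 := by
      cases K <;> simp only [LBlock.waveNumber] at h <;> first | rfl | omega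
    rw [h, h2]
    norm_num
  · refine functional_eq_zero_of_symmSum F _ hrot ?_ (blockVectors_mem_waveSpace hN s θ₀ lam p K b a)
    intro h3
    refine h (cos_wave_injective hN (K.two_mul_waveNumber_le hN) (by omega) ?_)
    rw [Nat.cast_zero, zero_mul, Real.cos_zero]
    linarith

/-- The momentum intertwines the rotation with that of the horizontal plane, on which `R + R⁻¹` is
`2 cos(2π/N)`: horizontal momentum sees only wave number `1`. -/
theorem horizontal_momentum_eq_zero (hN : 3 ≤ N) {p : Poles} {lam : ℝ} {q : ℕ} (hq : 2 * q ≤ N)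
    (hq1 : q ≠ 1) {v : Ambient N p} (hv : v ∈ waveSpace N p lam q) :
    momentum lam v 0 = 0 ∧ momentum lam v 1 = 0 := by
  set g := rotation N p lam with hg
  have hkap : g.kap = 1 := rfl
  have h1 : momentum lam (g.act v) = g.iso (momentum lam v) := by
    rw [g.momentum_act, hkap, one_smul]
  have h2 : momentum lam (g.act.symm v) = g.iso.symm (momentum lam v) := by
    have := g.momentum_act (g.act.symm v)
    rw [LinearEquiv.apply_symm_apply, hkap, one_smul] at this
    rw [this, LinearEquiv.symm_apply_apply]
  have h3 := mem_eigenspace_symmSum.mp hv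
  have h4 := congrArg (momentumMap N p lam) h3
  rw [map_add, map_smul, momentumMap_apply, momentumMap_apply, momentumMap_apply, h1, h2] at h4
  have h5 : Real.cos (q * (2 * Real.pi / N)) ≠ Real.cos (2 * Real.pi / N) := by
    intro h
    exact hq1 (cos_wave_injective hN hq (by omega) (by simpa using h))
  have e0 := congrFun h4 0
  have e1 := congrFun h4 1
  simp only [hg, rotation, Pi.add_apply, axisIso_apply, axisIso_symm_apply, cons_val,
    Pi.smul_apply, smul_eq_mul] at e0 e1
  have h6 := sub_ne_zero.mpr h5
  constructor
  · refine (mul_eq_zero.mp (?_ : _ * momentum lam v 0 = 0)).resolve_left h6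
    linear_combination -e0 / 2
  · refine (mul_eq_zero.mp (?_ : _ * momentum lam v 1 = 0)).resolve_left h6
    linear_combination -e1 / 2

/-- For wave number `1`, the vectors of `one` have contributions cancelling between the rings, or
between the poles. The coefficients in `bOne` are those that make the nonzero momenta `N cos θ₀`, `N
sin θ₀` and `2 * lam` cancel. -/
theorem horizontal_momentum_block_eq_zero (hN : 3 ≤ N) (s : Shape) (p : Poles) (θ₀ : ℝ) {lam : ℝ}
    (hlam : lam ≠ 0) (K : LBlock N) : ∀ (b : Fin 2) (a : Fin (hessSize p K)),
    momentum lam (blockVectors N s θ₀ lam p K b a) 0 = 0 ∧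
    momentum lam (blockVectors N s θ₀ lam p K b a) 1 = 0 := by
  by_cases h : K.waveNumber = 1
  swap
  · exact fun b a => horizontal_momentum_eq_zero hN (K.two_mul_waveNumber_le hN) h
      (blockVectors_mem_waveSpace hN s θ₀ lam p K b a)
  have hθ := momentum_ringMode_theta hN s p lam θ₀
  have hφ := momentum_ringMode_phi hN s p lam θ₀
  have hP := momentum_poleMode (N := N) s lam
  rcases K with _ | _ | _ | ⟨q, hq⟩ | ⟨q, hq⟩ | he
  · simp [LBlock.waveNumber] at h
  · cases p
    · refine Fin.forall_fin_two.mpr ⟨Fin.forall_fin_two.mpr ⟨?_, ?_⟩,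
        Fin.forall_fin_two.mpr ⟨?_, ?_⟩⟩
      · change momentum lam (βφ N s .absent θ₀ 1) 0 = 0 ∧ momentum lam (βφ N s .absent θ₀ 1) 1 = 0
        simp [βφ_eq, hφ]
      · change momentum lam (αθ' N s .absent θ₀ 1) 0 = 0 ∧
          momentum lam (αθ' N s .absent θ₀ 1) 1 = 0
        simp [αθ'_eq, hθ]
      · change momentum lam (αφ N s .absent θ₀ 1) 0 = 0 ∧ momentum lam (αφ N s .absent θ₀ 1) 1 = 0
        simp [αφ_eq, hφ]
      · change momentum lam (βθ' N s .absent θ₀ 1) 0 = 0 ∧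
          momentum lam (βθ' N s .absent θ₀ 1) 1 = 0
        simp [βθ'_eq, hθ]
    · refine Fin.forall_fin_two.mpr ⟨forall_fin_three.mpr ⟨?_, ?_, ?_⟩,
        forall_fin_three.mpr ⟨?_, ?_, ?_⟩⟩
      · change momentum lam (βφ N s .two θ₀ 1) 0 = 0 ∧ momentum lam (βφ N s .two θ₀ 1) 1 = 0
        simp [βφ_eq, hφ]
      · change momentum lam (αθ' N s .two θ₀ 1) 0 = 0 ∧
          momentum lam (αθ' N s .two θ₀ 1) 1 = 0
        simp [αθ'_eq, hθ]
      · change momentum lam (δxp N) 0 = 0 ∧ momentum lam (δxp N) 1 = 0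
        simp [δxp_eq s, hP]
      · change momentum lam (αφ N s .two θ₀ 1) 0 = 0 ∧ momentum lam (αφ N s .two θ₀ 1) 1 = 0
        simp [αφ_eq, hφ]
      · change momentum lam (βθ' N s .two θ₀ 1) 0 = 0 ∧
          momentum lam (βθ' N s .two θ₀ 1) 1 = 0
        simp [βθ'_eq, hθ]
      · change momentum lam (δyp N) 0 = 0 ∧ momentum lam (δyp N) 1 = 0
        simp [δyp_eq s, hP]
  · have h1 : momentum lam (Real.sin θ₀ • αθ N s p θ₀ 1 + Real.cos θ₀ • βφ' N s p θ₀ 1) 0 = 0 ∧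
        momentum lam (Real.sin θ₀ • αθ N s p θ₀ 1 + Real.cos θ₀ • βφ' N s p θ₀ 1) 1 = 0 := by
      rw [← momentumMap_apply, map_add, map_smul, map_smul, momentumMap_apply, momentumMap_apply,
        αθ_eq, βφ'_eq]
      simp [hθ, hφ]
      ring
    have h2 : momentum lam (Real.sin θ₀ • βθ N s p θ₀ 1 - Real.cos θ₀ • αφ' N s p θ₀ 1) 0 = 0 ∧
        momentum lam (Real.sin θ₀ • βθ N s p θ₀ 1 - Real.cos θ₀ • αφ' N s p θ₀ 1) 1 = 0 := by
      rw [← momentumMap_apply, map_sub, map_smul, map_smul, momentumMap_apply, momentumMap_apply,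
        βθ_eq, αφ'_eq]
      simp [hθ, hφ]
      ring
    cases p
    · exact Fin.forall_fin_two.mpr ⟨Fin.forall_fin_one.mpr h1, Fin.forall_fin_one.mpr h2⟩
    · refine Fin.forall_fin_two.mpr ⟨Fin.forall_fin_two.mpr ⟨h1, ?_⟩,
        Fin.forall_fin_two.mpr ⟨h2, ?_⟩⟩
      · change momentum lam (αθ N s .two θ₀ 1 - (N / (2 * lam) * Real.cos θ₀) • δxp' N) 0 = 0 ∧
          momentum lam (αθ N s .two θ₀ 1 - (N / (2 * lam) * Real.cos θ₀) • δxp' N) 1 = 0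
        rw [← momentumMap_apply, map_sub, map_smul, momentumMap_apply, momentumMap_apply,
          αθ_eq, δxp'_eq s, hP]
        simp [hθ]
        field_simp
        ring
      · change momentum lam (βθ N s .two θ₀ 1 - (N / (2 * lam) * Real.cos θ₀) • δyp' N) 0 = 0 ∧
          momentum lam (βθ N s .two θ₀ 1 - (N / (2 * lam) * Real.cos θ₀) • δyp' N) 1 = 0
        rw [← momentumMap_apply, map_sub, map_smul, momentumMap_apply, momentumMap_apply,
          βθ_eq, δyp'_eq s, hP]
        simp [hθ]
        field_simp
        ring
  · simp only [LBlock.waveNumber] at h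
    omega
  · simp only [LBlock.waveNumber] at h
    omega
  · simp only [LBlock.waveNumber] at h
    rw [Nat.even_iff] at he
    omega

theorem sliceVectors_mem_symplecticSlice (hN : 3 ≤ N) (s : Shape) (p : Poles) (θ₀ : ℝ) {lam : ℝ}
    (hlam : lam ≠ 0) (hμ : momentum lam (configuration N s p θ₀) ≠ 0) (i : SliceIndex N p) :
    sliceVectors N s p θ₀ lam i ∈ symplecticSlice lam (configuration N s p θ₀) := by
  obtain ⟨K, b, a⟩ := i
  change blockVectors N s θ₀ lam p K b a ∈ _
  refine ⟨?_, ?_, ?_⟩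
  · exact blockVectors_mem s θ₀ lam (fun p => tangentSubmodule (configuration N s p θ₀)) K
      (fun p => ringMode_mem_tangentSubmodule s p θ₀ theta_dot_spherical _)
      (fun p => ringMode_mem_tangentSubmodule s p θ₀ phi_dot_spherical _)
      (fun _ => poleMode_mem_tangentSubmodule s θ₀) p b a
  · obtain ⟨h0, h1⟩ := horizontal_momentum_block_eq_zero hN s p θ₀ hlam K b a
    have h2 := functional_block_eq_zero hN s p θ₀ lam (verticalMomentum N p lam)
      (verticalMomentum_act _) (verticalMomentum_act _) K b a
    ext m
    fin_cases m
    · exact h0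
    · exact h1
    · exact h2
  · intro η hη
    rw [momentum_configuration hN] at hη hμ
    have hm : 2 * momentumFactor N lam θ₀ p ≠ 0 := fun h => hμ (by simp [h])
    rw [cross_apply] at hη
    have e0 := congrFun hη 0
    have e1 := congrFun hη 1
    simp only [cons_val, mul_zero, sub_zero, zero_sub, Pi.zero_apply, neg_eq_zero] at e0 e1
    -- As `μ` is vertical and nonzero, its stabilizer algebra is the vertical axis, and a single
    -- orthogonality condition remains.
    have f1 := (mul_eq_zero.mp e0).resolve_right hm
    have f0 : η 0 = 0 := by
      rcases mul_eq_zero.mp e1 with h | h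
      · exact h
      · exact absurd h hm
    have hη' : η = η 2 • ![0, 0, 1] := by
      ext m
      fin_cases m
      · simpa using f0
      · simpa using f1
      · simp
    have h2 := functional_block_eq_zero hN s p θ₀ lam (verticalPairing (configuration N s p θ₀))
      (fun u => by
        rw [verticalPairing_act _ (rotation_configuration hN s p lam θ₀)]; simp [rotation])
      (fun u => by
        rw [verticalPairing_act _ (ringExchange_configuration hN s p lam θ₀)]
        simp [ringExchange]) K b a
    have h3 : ∀ i, generator η (configuration N s p θ₀) i
        = η 2 • generator ![0, 0, 1] (configuration N s p θ₀) i := fun i => by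
      conv_lhs => rw [hη']
      rw [generator, map_smul, LinearMap.smul_apply]
      rfl
    simp only [h3, dotProduct_smul, ← Finset.smul_sum]
    rw [smul_eq_mul]
    exact mul_eq_zero_of_right _ h2

end SliceMembership

/-! ### Nondegeneracy of the pairing between the two halves of each list -/

section OmegaBlocks

variable {N : ℕ}

/-- The pairing by `ω` of the two halves of a block. -/
def omegaPairing (N : ℕ) (s : Shape) (p : Poles) (θ₀ lam : ℝ) (K : LBlock N) :
    Matrix (Fin (hessSize p K)) (Fin (hessSize p K)) ℝ :=
  Matrix.of fun a a' => omegaForm lam (configuration N s p θ₀)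
    (blockVectors N s θ₀ lam p K 0 a) (blockVectors N s θ₀ lam p K 1 a')

theorem ringSum_of_dvd (ψ ψ' : ℝ) {q : ℕ} (hq : N ∣ 2 * q) :
    ringSum N q ψ ψ' = N * (Real.cos ψ * Real.cos ψ') := sum_cos_mul_cos_of_dvd ψ ψ' hq

theorem omegaForm_ringMode_phi_theta (s : Shape) (p : Poles) (lam θ₀ : ℝ) (q : ℕ)
    (ε ε' ψ ψ' : ℝ) :
    omegaForm lam (configuration N s p θ₀) (ringMode N s p θ₀ dSphericalPhi q ε ψ)
      (ringMode N s p θ₀ dSphericalTheta q ε' ψ')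
    = -(Real.sin θ₀ * (ringSum N q ψ' ψ
        - ε' * ε * ringSum N q (ψ' - q * offset N s) (ψ - q * offset N s))) := by
  rw [omegaForm_skew, omegaForm_ringMode_theta_phi]

variable [NeZero N]

theorem omegaForm_theta_phi (hN : 3 ≤ N) (s : Shape) (p : Poles) (lam θ₀ : ℝ) {q : ℕ}
    (hq : 0 < q) (hqN : 2 * q < N) (ε ε' ψ ψ' : ℝ) :
    omegaForm lam (configuration N s p θ₀) (ringMode N s p θ₀ dSphericalTheta q ε ψ)
      (ringMode N s p θ₀ dSphericalPhi q ε' ψ')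
    = N / 2 * Real.sin θ₀ * (1 - ε * ε') * Real.cos (ψ - ψ') := by
  rw [omegaForm_ringMode_theta_phi, ringSum_eq hN _ _ hq hqN, ringSum_eq hN _ _ hq hqN,
    sub_sub_sub_cancel_right]
  ring

theorem omegaForm_phi_theta (hN : 3 ≤ N) (s : Shape) (p : Poles) (lam θ₀ : ℝ) {q : ℕ}
    (hq : 0 < q) (hqN : 2 * q < N) (ε ε' ψ ψ' : ℝ) :
    omegaForm lam (configuration N s p θ₀) (ringMode N s p θ₀ dSphericalPhi q ε ψ)
      (ringMode N s p θ₀ dSphericalTheta q ε' ψ')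
    = -(N / 2 * Real.sin θ₀ * (1 - ε * ε') * Real.cos (ψ - ψ')) := by
  rw [omegaForm_skew, omegaForm_theta_phi hN s p lam θ₀ hq hqN, ← Real.cos_neg (ψ' - ψ), neg_sub,
    mul_comm ε' ε]

theorem det_omegaPairing_ne_zero (hN : 3 ≤ N) (s : Shape) (p : Poles) {θ₀ lam : ℝ}
    (hs : Real.sin θ₀ ≠ 0) (hc : Real.cos θ₀ ≠ 0) (hlam : lam ≠ 0)
    (hμ : momentumFactor N lam θ₀ p ≠ 0) (K : LBlock N) :
    (omegaPairing N s p θ₀ lam K).det ≠ 0 := by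
  have hN0 : (N : ℝ) ≠ 0 := Nat.cast_ne_zero.mpr (NeZero.ne N)
  set x := configuration N s p θ₀ with hx
  have hnθ : ∀ q ε ε' ψ ψ', omegaForm lam x (ringMode N s p θ₀ dSphericalTheta q ε ψ)
      (ringMode N s p θ₀ dSphericalTheta q ε' ψ') = 0 := omegaForm_self_frame s p lam θ₀ _
  have hnφ : ∀ q ε ε' ψ ψ', omegaForm lam x (ringMode N s p θ₀ dSphericalPhi q ε ψ)
      (ringMode N s p θ₀ dSphericalPhi q ε' ψ') = 0 := omegaForm_self_frame s p lam θ₀ _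
  have hθφ : ∀ {q : ℕ}, 0 < q → 2 * q < N → ∀ ε ε' ψ ψ', omegaForm lam x
      (ringMode N s p θ₀ dSphericalTheta q ε ψ) (ringMode N s p θ₀ dSphericalPhi q ε' ψ')
        = N / 2 * Real.sin θ₀ * (1 - ε * ε') * Real.cos (ψ - ψ') :=
    fun hq hqN => omegaForm_theta_phi hN s p lam θ₀ hq hqN
  have hφθ : ∀ {q : ℕ}, 0 < q → 2 * q < N → ∀ ε ε' ψ ψ', omegaForm lam x
      (ringMode N s p θ₀ dSphericalPhi q ε ψ) (ringMode N s p θ₀ dSphericalTheta q ε' ψ')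
        = -(N / 2 * Real.sin θ₀ * (1 - ε * ε') * Real.cos (ψ - ψ')) :=
    fun hq hqN => omegaForm_phi_theta hN s p lam θ₀ hq hqN
  rcases K with _ | _ | _ | ⟨q, hq⟩ | ⟨q, hq⟩ | he
  · have h : omegaForm lam x (αθ N s p θ₀ 0) (αφ' N s p θ₀ 0) ≠ 0 := by
      rw [αθ_eq, αφ'_eq, hx, omegaForm_ringMode_theta_phi, ringSum_of_dvd _ _ (by simp),
        ringSum_of_dvd _ _ (by simp)]
      simp [hs]
      intro h
      apply hN0
      linarith
    cases p <;> exact (Matrix.det_fin_one _).trans_ne h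
  · cases p
    · refine (Matrix.det_fin_two _).trans_ne ?_
      change omegaForm lam x (βφ N s .absent θ₀ 1) (αφ N s .absent θ₀ 1) *
          omegaForm lam x (αθ' N s .absent θ₀ 1) (βθ' N s .absent θ₀ 1) -
        omegaForm lam x (βφ N s .absent θ₀ 1) (βθ' N s .absent θ₀ 1) *
          omegaForm lam x (αθ' N s .absent θ₀ 1) (αφ N s .absent θ₀ 1) ≠ 0
      rw [βφ_eq, αφ_eq, αθ'_eq, βθ'_eq, hnφ, hnθ, hφθ one_pos (by omega), hθφ one_pos (by omega)]
      norm_num [hs, hN0]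
    · refine (Matrix.det_fin_three _).trans_ne ?_
      have hrp : ∀ w ε ε' ψ ψ', omegaForm lam x (ringMode N s .two θ₀ w 1 ε ψ)
        (poleMode N s ε' ψ') = 0 := fun w => omegaForm_ringMode_poleMode s lam θ₀ w 1
      have hpr : ∀ w ε ε' ψ ψ', omegaForm lam x (poleMode N s ε' ψ')
        (ringMode N s .two θ₀ w 1 ε ψ) = 0 := fun w => omegaForm_poleMode_ringMode s lam θ₀ w 1
      have hpp : ∀ ε ε' ψ ψ', omegaForm lam x (poleMode N s ε ψ) (poleMode N s ε' ψ')
        = lam * (1 + ε * ε') * Real.sin (ψ' - ψ) := omegaForm_poleMode s lam θ₀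
      have e00 : omegaPairing N s .two θ₀ lam .one 0 0 = 0 := by
        change omegaForm lam x (βφ N s .two θ₀ 1) (αφ N s .two θ₀ 1) = 0
        rw [βφ_eq, αφ_eq, hnφ]
      have e01 : omegaPairing N s .two θ₀ lam .one 0 1 = -(N * Real.sin θ₀) := by
        change omegaForm lam x (βφ N s .two θ₀ 1) (βθ' N s .two θ₀ 1) = _
        rw [βφ_eq, βθ'_eq, hφθ one_pos (by omega), sub_self, Real.cos_zero]
        ring
      have e02 : omegaPairing N s .two θ₀ lam .one 0 2 = 0 := by
        change omegaForm lam x (βφ N s .two θ₀ 1) (δyp N) = 0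
        rw [βφ_eq, δyp_eq s, hrp]
      have e10 : omegaPairing N s .two θ₀ lam .one 1 0 = N * Real.sin θ₀ := by
        change omegaForm lam x (αθ' N s .two θ₀ 1) (αφ N s .two θ₀ 1) = _
        rw [αθ'_eq, αφ_eq, hθφ one_pos (by omega), sub_self, Real.cos_zero]
        ring
      have e12 : omegaPairing N s .two θ₀ lam .one 1 2 = 0 := by
        change omegaForm lam x (αθ' N s .two θ₀ 1) (δyp N) = 0
        rw [αθ'_eq, δyp_eq s, hrp]
      have e20 : omegaPairing N s .two θ₀ lam .one 2 0 = 0 := by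
        change omegaForm lam x (δxp N) (αφ N s .two θ₀ 1) = 0
        rw [αφ_eq, δxp_eq s, hpr]
      have e21 : omegaPairing N s .two θ₀ lam .one 2 1 = 0 := by
        change omegaForm lam x (δxp N) (βθ' N s .two θ₀ 1) = 0
        rw [βθ'_eq, δxp_eq s, hpr]
      have e22 : omegaPairing N s .two θ₀ lam .one 2 2 = 2 * lam := by
        change omegaForm lam x (δxp N) (δyp N) = _
        rw [δyp_eq s, δxp_eq s, hpp, sub_zero, Real.sin_pi_div_two]
        ring
      rw [e00, e01, e02, e10, e12, e20, e21, e22]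
      have : (N * Real.sin θ₀) ^ 2 * (2 * lam) ≠ 0 := by positivity
      intro h
      exact this (by linear_combination h)
  · have e00 : omegaForm lam x (Real.sin θ₀ • αθ N s p θ₀ 1 + Real.cos θ₀ • βφ' N s p θ₀ 1)
        (Real.sin θ₀ • βθ N s p θ₀ 1 - Real.cos θ₀ • αφ' N s p θ₀ 1)
        = -(2 * N * Real.sin θ₀ ^ 2 * Real.cos θ₀) := by
      simp only [αθ_eq, βφ'_eq, βθ_eq, αφ'_eq, map_add, map_sub, map_smul, LinearMap.add_apply,
        LinearMap.smul_apply, smul_eq_mul, hnθ, hnφ,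
        hθφ one_pos (by omega : 2 * 1 < N), hφθ one_pos (by omega : 2 * 1 < N), sub_self,
        Real.cos_zero]
      ring
    cases p
    · refine (Matrix.det_fin_one _).trans_ne (e00.trans_ne ?_)
      exact neg_ne_zero.mpr (by positivity)
    · have hrp : ∀ w ε ε' ψ ψ', omegaForm lam x (ringMode N s .two θ₀ w 1 ε ψ)
        (poleMode N s ε' ψ') = 0 := fun w => omegaForm_ringMode_poleMode s lam θ₀ w 1
      have hpr : ∀ w ε ε' ψ ψ', omegaForm lam x (poleMode N s ε' ψ')
        (ringMode N s .two θ₀ w 1 ε ψ) = 0 := fun w => omegaForm_poleMode_ringMode s lam θ₀ w 1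
      have hpp : ∀ ε ε' ψ ψ', omegaForm lam x (poleMode N s ε ψ) (poleMode N s ε' ψ')
        = lam * (1 + ε * ε') * Real.sin (ψ' - ψ) := omegaForm_poleMode s lam θ₀
      have e01 : omegaForm lam x
          (Real.sin θ₀ • αθ N s .two θ₀ 1 + Real.cos θ₀ • βφ' N s .two θ₀ 1)
          (βθ N s .two θ₀ 1 - (N / (2 * lam) * Real.cos θ₀) • δyp' N)
          = -(N * Real.sin θ₀ * Real.cos θ₀) := by
        simp only [αθ_eq, βφ'_eq, βθ_eq, δyp'_eq s, map_add, map_sub, map_smul,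
          LinearMap.add_apply, LinearMap.smul_apply, smul_eq_mul, hnθ, hrp,
          hφθ one_pos (by omega : 2 * 1 < N), sub_self, Real.cos_zero]
        ring
      have e10 : omegaForm lam x
          (αθ N s .two θ₀ 1 - (N / (2 * lam) * Real.cos θ₀) • δxp' N)
          (Real.sin θ₀ • βθ N s .two θ₀ 1 - Real.cos θ₀ • αφ' N s .two θ₀ 1)
          = -(N * Real.sin θ₀ * Real.cos θ₀) := by
        simp only [αθ_eq, αφ'_eq, βθ_eq, δxp'_eq s, map_sub, map_smul,
          LinearMap.sub_apply, LinearMap.smul_apply, smul_eq_mul, hnθ, hpr,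
          hθφ one_pos (by omega : 2 * 1 < N), sub_self, Real.cos_zero]
        ring
      have e11 : omegaForm lam x
          (αθ N s .two θ₀ 1 - (N / (2 * lam) * Real.cos θ₀) • δxp' N)
          (βθ N s .two θ₀ 1 - (N / (2 * lam) * Real.cos θ₀) • δyp' N)
          = N ^ 2 * Real.cos θ₀ ^ 2 / (2 * lam) := by
        simp only [αθ_eq, βθ_eq, δxp'_eq s, δyp'_eq s, map_sub, map_smul,
          LinearMap.sub_apply, LinearMap.smul_apply, smul_eq_mul, hnθ, hpr, hrp, hpp,
          sub_zero, Real.sin_pi_div_two]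
        field_simp
        ring
      refine (Matrix.det_fin_two _).trans_ne ?_
      change omegaForm lam x
          (Real.sin θ₀ • αθ N s .two θ₀ 1 + Real.cos θ₀ • βφ' N s .two θ₀ 1)
          (Real.sin θ₀ • βθ N s .two θ₀ 1 - Real.cos θ₀ • αφ' N s .two θ₀ 1) *
        omegaForm lam x
          (αθ N s .two θ₀ 1 - (N / (2 * lam) * Real.cos θ₀) • δxp' N)
          (βθ N s .two θ₀ 1 - (N / (2 * lam) * Real.cos θ₀) • δyp' N) -
        omegaForm lam x
          (Real.sin θ₀ • αθ N s .two θ₀ 1 + Real.cos θ₀ • βφ' N s .two θ₀ 1)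
          (βθ N s .two θ₀ 1 - (N / (2 * lam) * Real.cos θ₀) • δyp' N) *
        omegaForm lam x
          (αθ N s .two θ₀ 1 - (N / (2 * lam) * Real.cos θ₀) • δxp' N)
          (Real.sin θ₀ • βθ N s .two θ₀ 1 - Real.cos θ₀ • αφ' N s .two θ₀ 1) ≠ 0
      rw [e00, e01, e10, e11]
      -- The opposite of the determinant. Its factor `N cos θ₀ + lam` is half the vertical momentum,
      -- so `μ ≠ 0` is what makes this pairing nondegenerate.
      have hne : N ^ 2 * Real.sin θ₀ ^ 2 * Real.cos θ₀ ^ 2 * (N * Real.cos θ₀ + lam) / lam ≠ 0 := by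
        have : (N * Real.cos θ₀ + lam : ℝ) ≠ 0 := hμ
        positivity
      intro h
      apply hne
      have h' : -(N ^ 2 * Real.sin θ₀ ^ 2 * Real.cos θ₀ ^ 2 * (N * Real.cos θ₀ + lam) / lam)
          = 0 := by
        rw [← h]
        field_simp
        ring
      linarith
  · have h : omegaForm lam x (αθ N s p θ₀ q) (βθ N s p θ₀ q) *
          omegaForm lam x (βφ' N s p θ₀ q) (αφ' N s p θ₀ q) -
        omegaForm lam x (αθ N s p θ₀ q) (αφ' N s p θ₀ q) *
          omegaForm lam x (βφ' N s p θ₀ q) (βθ N s p θ₀ q) ≠ 0 := by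
      rw [αθ_eq, βθ_eq, αφ'_eq, βφ'_eq, hnφ, hnθ, hφθ (by omega) hq.2, hθφ (by omega) hq.2]
      norm_num [hs, hN0]
    cases p <;> exact (Matrix.det_fin_two _).trans_ne h
  · have h : omegaForm lam x (αθ' N s p θ₀ q) (βθ' N s p θ₀ q) *
          omegaForm lam x (βφ N s p θ₀ q) (αφ N s p θ₀ q) -
        omegaForm lam x (αθ' N s p θ₀ q) (αφ N s p θ₀ q) *
          omegaForm lam x (βφ N s p θ₀ q) (βθ' N s p θ₀ q) ≠ 0 := by
      rw [αθ'_eq, βθ'_eq, αφ_eq, βφ_eq, hnφ, hnθ, hφθ (by omega) hq.2, hθφ (by omega) hq.2]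
      norm_num [hs, hN0]
    cases p <;> exact (Matrix.det_fin_two _).trans_ne h
  · have hd : N ∣ 2 * (N / 2) := by
      rw [Nat.two_mul_div_two_of_even he]
    -- For `Nd` the offset is a quarter period of the mode `N / 2`: phase `0` lives on the (+)ring
    -- alone and phase `π/2` on the (-)ring alone. For `Nh` the phase `π/2` vanishes on both rings,
    -- which is why that list contains no `β`.
    have hoff : ((N / 2 : ℕ) : ℝ) * offset N .Nd = Real.pi / 2 := by
      rw [offset, Nat.cast_div he.two_dvd two_ne_zero]
      push_cast
      field_simp
    cases s
    · have h : omegaForm lam x (αθ' N .Nd p θ₀ (N / 2)) (βθ' N .Nd p θ₀ (N / 2)) *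
            omegaForm lam x (βφ N .Nd p θ₀ (N / 2)) (αφ N .Nd p θ₀ (N / 2)) -
          omegaForm lam x (αθ' N .Nd p θ₀ (N / 2)) (αφ N .Nd p θ₀ (N / 2)) *
            omegaForm lam x (βφ N .Nd p θ₀ (N / 2)) (βθ' N .Nd p θ₀ (N / 2)) ≠ 0 := by
        rw [αθ'_eq, βθ'_eq, αφ_eq, βφ_eq, hnφ, hnθ, hx, omegaForm_ringMode_theta_phi,
          omegaForm_ringMode_phi_theta, ringSum_of_dvd _ _ hd, ringSum_of_dvd _ _ hd,
          ringSum_of_dvd _ _ hd, ringSum_of_dvd _ _ hd, hoff]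
        simp [hs, hN0]
      cases p <;> exact (Matrix.det_fin_two _).trans_ne h
    · have h : omegaForm lam x (αθ N .Nh p θ₀ (N / 2)) (αφ N .Nh p θ₀ (N / 2)) *
            omegaForm lam x (αθ' N .Nh p θ₀ (N / 2)) (αφ' N .Nh p θ₀ (N / 2)) -
          omegaForm lam x (αθ N .Nh p θ₀ (N / 2)) (αφ' N .Nh p θ₀ (N / 2)) *
            omegaForm lam x (αθ' N .Nh p θ₀ (N / 2)) (αφ N .Nh p θ₀ (N / 2)) ≠ 0 := by
        rw [αθ_eq, αθ'_eq, αφ_eq, αφ'_eq, hx]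
        simp only [omegaForm_ringMode_theta_phi, ringSum_of_dvd _ _ hd, offset]
        simp [hs, NeZero.ne N]
      cases p <;> exact (Matrix.det_fin_two _).trans_ne h

end OmegaBlocks

/-! ### Invertibility of the symplectic matrix and linear independence -/

section Basis

variable {N : ℕ}

theorem omegaMatrix_apply (s : Shape) (p : Poles) (θ₀ lam : ℝ) (i j : SliceIndex N p) :
    omegaMatrix N s p θ₀ lam i j = omegaForm lam (configuration N s p θ₀)
      (sliceVectors N s p θ₀ lam i) (sliceVectors N s p θ₀ lam j) := rfl

variable [NeZero N]

/-- On each list, with pairing matrix `P`, the matrix of `ω` has zero diagonal blocks and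
off-diagonal blocks `P` and `-Pᵀ`; a kernel vector is therefore killed by every `P`, on one side or
the other. -/
theorem omegaMatrix_mulVec (hN : 3 ≤ N) (s : Shape) (p : Poles) (θ₀ lam : ℝ)
    (v : SliceIndex N p → ℝ) (K : LBlock N) (a : Fin (hessSize p K)) :
    (omegaMatrix N s p θ₀ lam *ᵥ v) ⟨K, 0, a⟩
        = (omegaPairing N s p θ₀ lam K *ᵥ fun a' => v ⟨K, 1, a'⟩) a ∧
    (omegaMatrix N s p θ₀ lam *ᵥ v) ⟨K, 1, a⟩
        = -((fun a' => v ⟨K, 0, a'⟩) ᵥ* omegaPairing N s p θ₀ lam K) a := by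
  have h : ∀ b, (omegaMatrix N s p θ₀ lam *ᵥ v) ⟨K, b, a⟩ =
      ∑ b' : Fin 2, ∑ a' : Fin (hessSize p K),
        omegaForm lam (configuration N s p θ₀) (blockVectors N s θ₀ lam p K b a)
          (blockVectors N s θ₀ lam p K b' a') * v ⟨K, b', a'⟩ := by
    intro b
    rw [mulVec, dotProduct, Fintype.sum_sigma, Finset.sum_eq_single K, Fintype.sum_prod_type]
    · rfl
    · intro K' _ hK'
      refine Finset.sum_eq_zero fun y _ => ?_
      obtain ⟨b', a'⟩ := y
      have := omega_block_eq_zero hN s p θ₀ lam (Ne.symm hK') b b' a a'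
      rw [omegaMatrix_apply]
      exact mul_eq_zero_of_left this _
    · intro h
      exact absurd (Finset.mem_univ K) h
  constructor
  · rw [h, Fin.sum_univ_two, Finset.sum_eq_zero, zero_add]
    · rfl
    · intro a' _
      rw [omega_half_eq_zero hN, zero_mul]
  · rw [h, Fin.sum_univ_two, add_comm, Finset.sum_eq_zero, zero_add, vecMul, dotProduct,
      ← Finset.sum_neg_distrib]
    · refine Finset.sum_congr rfl fun a' _ => ?_
      rw [omegaForm_skew, omegaPairing, Matrix.of_apply]
      ring
    · intro a' _
      rw [omega_half_eq_zero hN, zero_mul]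

theorem det_omegaMatrix_ne_zero (hN : 3 ≤ N) (s : Shape) (p : Poles) {θ₀ lam : ℝ}
    (hs : Real.sin θ₀ ≠ 0) (hc : Real.cos θ₀ ≠ 0) (hlam : lam ≠ 0)
    (hμ : momentumFactor N lam θ₀ p ≠ 0) : (omegaMatrix N s p θ₀ lam).det ≠ 0 := by
  intro h
  obtain ⟨v, hv, hv0⟩ := Matrix.exists_mulVec_eq_zero_iff.mpr h
  apply hv
  have hdet := det_omegaPairing_ne_zero hN s p hs hc hlam hμ
  funext ⟨K, b, a⟩
  have h1 : (fun a' => v ⟨K, 1, a'⟩) = 0 := by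
    refine Matrix.eq_zero_of_mulVec_eq_zero (hdet K) (funext fun a => ?_)
    rw [← (omegaMatrix_mulVec hN s p θ₀ lam v K a).1, hv0]
    rfl
  have h0 : (fun a' => v ⟨K, 0, a'⟩) = 0 := by
    refine Matrix.eq_zero_of_vecMul_eq_zero (hdet K) (funext fun a => ?_)
    rw [← neg_inj, ← (omegaMatrix_mulVec hN s p θ₀ lam v K a).2, hv0]
    simp
  obtain rfl | rfl : b = 0 ∨ b = 1 := by omega
  · exact congrFun h0 a
  · exact congrFun h1 a

theorem linearIndependent_of_det_gram_ne_zero {V ι : Type*} [AddCommGroup V] [Module ℝ V]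
    [Fintype ι] [DecidableEq ι] (B : V →ₗ[ℝ] V →ₗ[ℝ] ℝ) (u : ι → V)
    (h : (Matrix.of fun i j => B (u i) (u j)).det ≠ 0) : LinearIndependent ℝ u := by
  rw [Fintype.linearIndependent_iff]
  intro c hc
  have h1 : (Matrix.of fun i j => B (u i) (u j)) *ᵥ c = 0 := by
    funext i
    have h2 := congrArg (B (u i)) hc
    rw [map_sum, map_zero] at h2
    simp only [map_smul, smul_eq_mul] at h2
    rw [mulVec, dotProduct, Pi.zero_apply, ← h2]
    exact Finset.sum_congr rfl fun j _ => mul_comm _ _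
  exact fun i => congrFun (Matrix.eq_zero_of_mulVec_eq_zero h h1) i

theorem linearIndependent_sliceVectors (hN : 3 ≤ N) (s : Shape) (p : Poles) {θ₀ lam : ℝ}
    (hs : Real.sin θ₀ ≠ 0) (hc : Real.cos θ₀ ≠ 0) (hlam : lam ≠ 0)
    (hμ : momentumFactor N lam θ₀ p ≠ 0) : LinearIndependent ℝ (sliceVectors N s p θ₀ lam) :=
  linearIndependent_of_det_gram_ne_zero (omegaForm lam (configuration N s p θ₀)) _
    (det_omegaMatrix_ne_zero hN s p hs hc hlam hμ)

end Basis

/-! ### Dimension of the symplectic slice -/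

section Dimension

variable {N : ℕ}

/-- The blocks, listed. -/
def LBlock.equivSum (N : ℕ) : LBlock N ≃
    -- For either parity of `N`, the condition `q < (N + 1) / 2` with integer division is `2 * q <
    -- N`.
    Fin 3 ⊕ (Finset.Ico 2 ((N + 1) / 2)) ⊕ (Finset.Ico 2 ((N + 1) / 2)) ⊕
      {_u : Unit // Even N} where
  toFun
    | .zero => .inl 0
    | .one => .inl 1
    | .bOne => .inl 2
    | .low q hq => .inr (.inl ⟨q, Finset.mem_Ico.mpr ⟨hq.1, by omega⟩⟩)
    | .low' q hq => .inr (.inr (.inl ⟨q, Finset.mem_Ico.mpr ⟨hq.1, by omega⟩⟩))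
    | .half h => .inr (.inr (.inr ⟨(), h⟩))
  invFun
    | .inl 0 => .zero
    | .inl 1 => .one
    | .inl 2 => .bOne
    | .inr (.inl q) => .low q.1 (by have := Finset.mem_Ico.mp q.2; omega)
    | .inr (.inr (.inl q)) => .low' q.1 (by have := Finset.mem_Ico.mp q.2; omega)
    | .inr (.inr (.inr h)) => .half h.2
  left_inv K := by cases K <;> rfl
  right_inv y := by
    rcases y with y | y | y | y
    · fin_cases y <;> rfl
    · rfl
    · rfl
    · rfl

theorem card_sliceIndex (hN : 3 ≤ N) (p : Poles) :
    Fintype.card (SliceIndex N p) + 4 = 2 * (2 * N + p.count) := by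
  have h : Fintype.card (SliceIndex N p) = ∑ K : LBlock N, 2 * hessSize p K := by
    rw [Fintype.card_sigma]
    simp
  have he : Fintype.card {_u : Unit // Even N} = 1 - N % 2 := by
    by_cases h : Even N
    · have h2 := Nat.even_iff.mp h
      simp [Fintype.card_subtype, h, h2]
    · have h2 := Nat.not_even_iff.mp h
      simp [h, h2]
  rw [h, ← Equiv.sum_comp (LBlock.equivSum N).symm, Fintype.sum_sum_type, Fintype.sum_sum_type,
    Fintype.sum_sum_type, Fin.sum_univ_three]
  have e1 : ∀ q, hessSize p ((LBlock.equivSum N).symm (.inr (.inl q))) = 2 := fun q => by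
    cases p <;> rfl
  have e2 : ∀ q, hessSize p ((LBlock.equivSum N).symm (.inr (.inr (.inl q)))) = 2 := fun q => by
    cases p <;> rfl
  have e3 : ∀ q, hessSize p ((LBlock.equivSum N).symm (.inr (.inr (.inr q)))) = 2 := fun q => by
    cases p <;> rfl
  have e4 : hessSize p ((LBlock.equivSum N).symm (.inl 0)) +
      hessSize p ((LBlock.equivSum N).symm (.inl 1)) +
      hessSize p ((LBlock.equivSum N).symm (.inl 2)) = 4 + p.count := by
    cases p <;> rfl
  simp only [e1, e2, e3, Finset.sum_const, Finset.card_univ, he, smul_eq_mul, Fintype.card_coe,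
    Nat.card_Ico]
  omega

theorem configuration_ne_zero (s : Shape) (p : Poles) (θ₀ : ℝ) (i : Vortex N p) :
    configuration N s p θ₀ i ≠ 0 := by
  have hsph : ∀ θ t, spherical θ t ≠ 0 := by
    intro θ t h
    have h0 := congrFun h 0
    have h1 := congrFun h 1
    have h2 := congrFun h 2
    simp only [spherical, cons_val, Pi.zero_apply] at h0 h1 h2
    have e1 := Real.cos_sq_add_sin_sq θ
    have e2 := Real.cos_sq_add_sin_sq t
    have : (1 : ℝ) = 0 := by
      linear_combination -e1 - Real.sin θ ^ 2 * e2 + Real.sin θ * Real.cos t * h0 +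
        Real.sin θ * Real.sin t * h1 + Real.cos θ * h2
    exact one_ne_zero this
  rcases i with j | j | k
  · exact hsph _ _
  · exact hsph _ _
  · intro h
    have h2 := congrFun h 2
    simp only [configuration] at h2
    split_ifs at h2 <;> simp at h2

/-- The normal directions of the symplectic slice: directions orthogonal to the spheres, gradients
of the components of the centre of vorticity, and the rotation around the vertical axis. -/
def normalMap {p : Poles} (lam : ℝ) (x : Ambient N p) :
    ((Vortex N p → ℝ) × (Fin 3 → ℝ) × ℝ) →ₗ[ℝ] Ambient N p where
  toFun y i := y.1 i • x i + vorticity lam i • y.2.1 + y.2.2 • generator ![0, 0, 1] x i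
  map_add' y z := by
    funext i
    simp only [Prod.fst_add, Prod.snd_add, Pi.add_apply, add_smul, smul_add]
    abel
  map_smul' c y := by
    funext i
    simp only [Prod.smul_fst, Prod.smul_snd, Pi.smul_apply, smul_add, smul_smul, smul_eq_mul,
      RingHom.id_apply, mul_comm c]

variable [NeZero N]

theorem normalMap_injective (hN : 3 ≤ N) (s : Shape) (p : Poles) (lam : ℝ) {θ₀ : ℝ}
    (hs : Real.sin θ₀ ≠ 0) :
    Function.Injective (normalMap lam (configuration N s p θ₀)) := by
  rw [injective_iff_map_eq_zero]
  rintro ⟨a, b, c⟩ h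
  -- Projecting a relation on the directions `∂/∂φ` and `∂/∂θ` eliminates the radial coefficients
  -- `a`.
  have key : ∀ (j : Fin N) (t : ℝ), configuration N s p θ₀ (.inl j) = spherical θ₀ t →
      -b 0 * Real.sin t + b 1 * Real.cos t + c * Real.sin θ₀ = 0 ∧
      Real.cos θ₀ * (b 0 * Real.cos t + b 1 * Real.sin t) - Real.sin θ₀ * b 2 = 0 := by
    intro j t hj
    have h1 := congrFun h (.inl j)
    simp only [normalMap, LinearMap.coe_mk, AddHom.coe_mk, generator, hj, vorticity,
      cross_apply, spherical] at h1
    have f0 := congrFun h1 0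
    have f1 := congrFun h1 1
    have f2 := congrFun h1 2
    simp only [cons_val, Pi.add_apply, Pi.smul_apply, Pi.zero_apply, smul_eq_mul] at f0 f1 f2
    have e := Real.cos_sq_add_sin_sq t
    constructor
    · linear_combination -Real.sin t * f0 + Real.cos t * f1 - c * Real.sin θ₀ * e
    · linear_combination Real.cos θ₀ * (Real.cos t * f0 + Real.sin t * f1) - Real.sin θ₀ * f2
        - a (.inl j) * Real.cos θ₀ * Real.sin θ₀ * e
  have k0 := key 0 0 (by simp [configuration, longitude])
  have k1 := key 1 (2 * Real.pi / N) (by rw [configuration, longitude_one hN])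
  have k2 := key (-1) (-(2 * Real.pi / N)) (by
    have := periodic_longitude_neg (spherical_periodic θ₀) (1 : Fin N) 0
    rw [add_zero, add_zero, longitude_one hN] at this
    exact this)
  simp at k0 k2
  have hsin := sin_two_pi_div_ne_zero hN
  have hcos := sub_ne_zero.mpr (cos_two_pi_div_ne_one hN)
  -- The equations at longitudes `±2π/N` are split into odd and even parts: the odd part isolates `b
  -- 0`, and the even part minus the equation at longitude `0` isolates `b 1`.
  have b0 : b 0 = 0 := by
    refine (mul_eq_zero.mp (?_ : b 0 * Real.sin (2 * Real.pi / N) = 0)).resolve_right hsin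
    linear_combination (k2.1 - k1.1) / 2
  have b1 : b 1 = 0 := by
    refine (mul_eq_zero.mp (?_ : b 1 * (Real.cos (2 * Real.pi / N) - 1) = 0)).resolve_right hcos
    linear_combination (k2.1 + k1.1) / 2 - k0.1
  have c0 : c = 0 := by
    refine (mul_eq_zero.mp (?_ : c * Real.sin θ₀ = 0)).resolve_right hs
    linear_combination k0.1 - b1
  have b2 : b 2 = 0 := by
    refine (mul_eq_zero.mp (?_ : Real.sin θ₀ * b 2 = 0)).resolve_left hs
    linear_combination -k0.2 + Real.cos θ₀ * b0
  have hb : b = 0 := by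
    ext m
    fin_cases m
    · exact b0
    · exact b1
    · exact b2
  subst hb c0
  have ha : a = 0 := by
    funext i
    have h1 := congrFun h i
    simp only [normalMap, LinearMap.coe_mk, AddHom.coe_mk, smul_zero, zero_smul, add_zero,
      Pi.zero_apply] at h1
    exact (smul_eq_zero.mp h1).resolve_right (configuration_ne_zero s p θ₀ i)
  rw [ha]
  rfl

/-- The range of `normalMap` is orthogonal to the slice, so a common vector has zero norm. -/
theorem disjoint_symplecticSlice_normal (hN : 3 ≤ N) (s : Shape) (p : Poles) (lam θ₀ : ℝ) :
    Disjoint (symplecticSlice lam (configuration N s p θ₀))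
      (LinearMap.range (normalMap lam (configuration N s p θ₀))) := by
  rw [Submodule.disjoint_def]
  rintro v ⟨ht, hm, hr⟩ ⟨⟨a, b, c⟩, hv⟩
  have hr' := hr ![0, 0, 1] (by rw [momentum_configuration hN, cross_apply]; simp)
  have hm' : ∑ i, v i ⬝ᵥ (vorticity lam i • b) = 0 := by
    have h1 : momentum lam v ⬝ᵥ b = 0 := by rw [hm, zero_dotProduct]
    rw [momentum, sum_dotProduct] at h1
    rw [← h1]
    exact Finset.sum_congr rfl fun i _ => by rw [dotProduct_smul, smul_dotProduct]
  have h0 : ∑ i, v i ⬝ᵥ v i = 0 := by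
    have h1 : ∀ i, v i ⬝ᵥ v i = v i ⬝ᵥ (vorticity lam i • b)
        + c * (v i ⬝ᵥ generator ![0, 0, 1] (configuration N s p θ₀) i) := by
      intro i
      have h2 := congrFun hv i
      simp only [normalMap, LinearMap.coe_mk, AddHom.coe_mk] at h2
      have h3 := congrArg (fun u => v i ⬝ᵥ u) h2
      simp only [dotProduct_add, dotProduct_smul c, dotProduct_smul (a i), ht i, mul_zero,
        zero_add, smul_eq_mul] at h3
      exact h3.symm
    simp only [h1, Finset.sum_add_distrib, ← Finset.mul_sum, hm', hr', mul_zero, add_zero]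
  have hnn : ∀ i ∈ Finset.univ, 0 ≤ v i ⬝ᵥ v i := fun i _ =>
    Finset.sum_nonneg fun m _ => mul_self_nonneg _
  funext i
  exact dotProduct_self_eq_zero.mp ((Finset.sum_eq_zero_iff_of_nonneg hnn).mp h0 i
    (Finset.mem_univ i))

/-- One radial direction per vortex, three momentum gradients and one rotation are independent
normals; removing them from `3(2N + k_p)` dimensions leaves `2(2N + k_p) - 4`, the number of listed
vectors. -/
theorem finrank_symplecticSlice_le (hN : 3 ≤ N) (s : Shape) (p : Poles) (lam : ℝ) {θ₀ : ℝ}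
    (hs : Real.sin θ₀ ≠ 0) :
    Module.finrank ℝ (symplecticSlice lam (configuration N s p θ₀))
      ≤ Fintype.card (SliceIndex N p) := by
  have h1 := Submodule.finrank_add_finrank_le_of_disjoint
    (disjoint_symplecticSlice_normal hN s p lam θ₀)
  rw [LinearMap.finrank_range_of_inj (normalMap_injective hN s p lam hs)] at h1
  have h2 : Module.finrank ℝ ((Vortex N p → ℝ) × (Fin 3 → ℝ) × ℝ) = 2 * N + p.count + 4 := by
    simp
    ring
  have h3 : Module.finrank ℝ (Ambient N p) = 3 * (2 * N + p.count) := by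
    simp [Module.finrank_pi_fintype]
    ring
  have h4 := card_sliceIndex hN p
  omega

theorem span_sliceVectors (hN : 3 ≤ N) (s : Shape) (p : Poles) {θ₀ lam : ℝ}
    (hs : Real.sin θ₀ ≠ 0) (hc : Real.cos θ₀ ≠ 0) (hlam : lam ≠ 0)
    (hμ : momentum lam (configuration N s p θ₀) ≠ 0)
    (hμ' : momentumFactor N lam θ₀ p ≠ 0) :
    Submodule.span ℝ (Set.range (sliceVectors N s p θ₀ lam))
      = symplecticSlice lam (configuration N s p θ₀) := by
  apply Submodule.eq_of_le_of_finrank_le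
  · rw [Submodule.span_le]
    rintro _ ⟨i, rfl⟩
    exact sliceVectors_mem_symplecticSlice hN s p θ₀ hlam hμ i
  · rw [finrank_span_eq_card (linearIndependent_sliceVectors hN s p hs hc hlam hμ')]
    exact finrank_symplecticSlice_le hN s p lam hs

end Dimension

/-! ### Inverses and products of block diagonal matrices -/

section Linearized

/-- A matrix which is block diagonal and invertible has a block diagonal inverse. -/
theorem inv_apply_eq_zero_of_block {ι β : Type*} [Fintype ι] [DecidableEq ι] [DecidableEq β]
    (f : ι → β) {M : Matrix ι ι ℝ} (hM : IsUnit M.det) (h : ∀ i j, f i ≠ f j → M i j = 0)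
    {i j : ι} (hij : f i ≠ f j) : M⁻¹ i j = 0 := by
  -- `D` is the projector on the block of `i`. A block diagonal `M` commutes with it, hence so does
  -- `M⁻¹`, and the entry `(i, j)` of this identity is the claim.
  set D : Matrix ι ι ℝ := Matrix.diagonal fun k => if f k = f i then 1 else 0 with hD
  have hcomm : D * M = M * D := by
    ext k l
    rw [hD, Matrix.diagonal_mul, Matrix.mul_diagonal]
    by_cases hkl : f k = f l
    · rw [hkl, mul_comm]
    · rw [h k l hkl, mul_zero, zero_mul]
  have hcomm' : M⁻¹ * D = D * M⁻¹ := by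
    calc M⁻¹ * D = M⁻¹ * (D * M) * M⁻¹ := by
          rw [Matrix.mul_assoc, Matrix.mul_assoc, Matrix.mul_nonsing_inv _ hM, Matrix.mul_one]
      _ = D * M⁻¹ := by
          rw [hcomm, ← Matrix.mul_assoc, Matrix.nonsing_inv_mul _ hM, Matrix.one_mul]
  have h1 := congrFun (congrFun hcomm' i) j
  rw [hD, Matrix.mul_diagonal, Matrix.diagonal_mul, if_neg (Ne.symm hij), if_pos rfl, mul_zero,
    one_mul] at h1
  exact h1.symm

theorem mul_apply_eq_zero_of_block {ι β : Type*} [Fintype ι] (f : ι → β) {A B : Matrix ι ι ℝ}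
    (hA : ∀ i j, f i ≠ f j → A i j = 0) (hB : ∀ i j, f i ≠ f j → B i j = 0)
    {i j : ι} (hij : f i ≠ f j) : (A * B) i j = 0 := by
  rw [Matrix.mul_apply]
  refine Finset.sum_eq_zero fun k _ => ?_
  by_cases hik : f i = f k
  · rw [hB k j (hik ▸ hij), mul_zero]
  · rw [hA i k hik, zero_mul]

end Linearized

end PointVortex

end

/-! ### Assembly of the theorem -/

theorem mainTheorem5 (N : ℕ) (hN : 3 ≤ N) (s : PointVortex.Shape) (p : PointVortex.Poles)
    (θ₀ : ℝ) (hθ₀ : 0 < θ₀) (hθ₀π : θ₀ < Real.pi) (hequator : θ₀ ≠ Real.pi / 2)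
    (lam : ℝ) (hlam : lam ≠ 0)
    (hμ : PointVortex.momentum lam (PointVortex.configuration N s p θ₀) ≠ 0) :
    LinearIndependent ℝ (PointVortex.sliceVectors N s p θ₀ lam) ∧
    Submodule.span ℝ (Set.range (PointVortex.sliceVectors N s p θ₀ lam)) =
      PointVortex.symplecticSlice lam (PointVortex.configuration N s p θ₀) ∧
    IsUnit (PointVortex.omegaMatrix N s p θ₀ lam).det ∧
    ∃ ξ : Fin 3 → ℝ,
      (∀ ξ' : Fin 3 → ℝ,
        PointVortex.IsRelativeEquilibrium lam (PointVortex.configuration N s p θ₀) ξ' ↔ ξ' = ξ) ∧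
      (∀ i j : PointVortex.SliceIndex N p,
        PointVortex.hessBlock i ≠ PointVortex.hessBlock j →
          PointVortex.hessianMatrix N s p θ₀ lam ξ i j = 0) ∧
      (∀ i j : PointVortex.SliceIndex N p, i.1 ≠ j.1 →
        PointVortex.linearizedMatrix N s p θ₀ lam ξ i j = 0) := by
  have : NeZero N := ⟨by omega⟩
  have hs : Real.sin θ₀ ≠ 0 := (Real.sin_pos_of_pos_of_lt_pi hθ₀ hθ₀π).ne'
  have hc : Real.cos θ₀ ≠ 0 := by
    intro h
    refine hequator (Real.injOn_cos ⟨hθ₀.le, hθ₀π.le⟩ ⟨by positivity, ?_⟩ ?_)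
    · linarith [Real.pi_pos]
    · rw [h, Real.cos_pi_div_two]
  have hμ' : PointVortex.momentumFactor N lam θ₀ p ≠ 0 := fun h =>
    hμ (by rw [PointVortex.momentum_configuration hN, h]; simp)
  have hunit : IsUnit (PointVortex.omegaMatrix N s p θ₀ lam).det :=
    isUnit_iff_ne_zero.mpr (PointVortex.det_omegaMatrix_ne_zero hN s p hs hc hlam hμ')
  obtain ⟨c, hξ⟩ := PointVortex.exists_angularVelocity hN s p lam hs
  refine ⟨PointVortex.linearIndependent_sliceVectors hN s p hs hc hlam hμ',
    PointVortex.span_sliceVectors hN s p hs hc hlam hμ hμ', hunit, ![0, 0, c], fun ξ' => ?_,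
    PointVortex.hessian_block_eq_zero hN s p θ₀ lam c, fun i j hij => ?_⟩
  · exact ⟨PointVortex.angularVelocity_unique hN s p lam hs hξ, fun h => h ▸ hξ⟩
  · refine PointVortex.mul_apply_eq_zero_of_block Sigma.fst (fun i j h => ?_) (fun i j h => ?_) hij
    · exact PointVortex.inv_apply_eq_zero_of_block Sigma.fst hunit
        -- `ω` couples the two halves of a list, so `Ω` and its inverse are block diagonal only
        -- along whole lists; the finer blocks of the Hessian are merged accordingly.
        (fun i j h => PointVortex.omega_block_eq_zero hN s p θ₀ lam h _ _ _ _) h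
    · exact PointVortex.hessian_block_eq_zero hN s p θ₀ lam c i j
        (fun h' => h (congrArg Prod.fst h'))
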